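/- Let $0<q<1$. Let $U_q\mathfrak{su}(1,1)$ be the $*$-algebra generated by $E,F,K^{\pm1}$ with $KE=q^{-2}EK$, $KF=q^{2}FK$, $EF-FE=\frac{K-K^{-1}}{q^{-1}-q}$, $K^*=K$, $E^*=-qK^{-1}F$. A $*$-representation acts on a dense subspace (a module) of a Hilbert space $H$, and is irreducible if this module is simple. Scalar products are linear in the first argument. Write $(a;t)_\infty=\prod_{k\ge0}(1-at^k)$, $(a;t)_\beta=(a;t)_\infty/(at^\beta;t)_\infty$, with $(a;t)_k=\prod_{j=0}^{k-1}(1-at^j)$ for $k\in\mathbb Z_{\ge 0}$, and let $\delta_{|\lambda|=r}$ be the rotation-invariant probability measure on the circle $|\lambda|=r$. For real $c,d>0$ with $cd=1$ and a sign $s=\pm1$ put $x=sK$, $y=-(1-q^2)xE$, $\zeta=(qx-c)^{-1}y$ (on the module), and let $\hat Z$ be the closure in $H$ of the normalized operator $(c/d)^{1/2}\zeta$. For a bounded domain $D$ and a finite measure $\nu$ on $\overline D$, let $\mathcal H(D,\nu)$ be the closure in $L^2(\nu)$ of the functions that are holomorphic in $D$ and continuous in $\overline D$; an element $u$ is identified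 with a holomorphic function $f$ on $D$ if $u=f$ $\nu$-a.e. in $D$ and $u$ is the $L^2(\nu)$-limit of functions $g_n$, holomorphic in $D$ and continuous in $\overline D$, with $g_n\to f$ locally uniformly in $D$. (1) Let $l\le-\frac12$ be real, $|\epsilon|\le\frac12$, $l-\epsilon\in\mathbb Z$, and let $T^+_{l,\epsilon}$ be the irreducible $*$-representation with a highest weight vector $v\neq0$: $Ev=0$, $Kv=q^{-2l}v$. Take $c=q^{2l+1}$, $d=c^{-1}$, $s=1$. There is a holomorphic $\Theta_+:\{|\lambda|<1\}\to H$ with $\hat Z\Theta_+(\lambda)=\lambda\Theta_+(\lambda)$ and $$(\Theta_+(\lambda),\Theta_+(\mu))=\frac1{(\lambda\bar\mu;q^2)_{-2l}},$$ such that $\theta_+:f\mapsto\big(\lambda\mapsto(f,\Theta_+(\bar\lambda))\big)$ takes values in functions holomorphic in the unit disc and is a unitary isomorphism of $H$ onto $\mathcal H(\{|\lambda|<1\},\nu^+_{l})$, where $$\nu^+_{l}=(1-q^{-2(2l+1)})\sum_{k=0}^\infty q^{2k}\frac{(q^{2(k+1)};q^2)_\infty}{(q^{2(k-2l-1)};q^2)_\infty}\,\delta_{|\lambda|=q^k}\quad(l<-\tfrac12),\qquad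 \nu^+_{-1/2}=\delta_{|\lambda|=1}.$$ (2) Let $2\alpha+1=N\in\{1,2,\dots\}$, $|\epsilon|\le\frac12$, and let $T$ be the strange series representation of spin $l=\alpha+\frac{\pi i}{2\log q}$ and parity $\epsilon$: the irreducible $*$-representation in which the Casimir element $\frac12(EF+FE)+\frac{q^{-1}+q}{2(q^{-1}-q)^2}(K-2+K^{-1})$ acts by $\frac{(q^l-q^{-l})(q^{l+1}-q^{-l-1})}{(q^{-1}-q)^2}$ and $K$ has the eigenvalue $q^{-2\epsilon}$ (so that its eigenvalues are of the form $q^{2(k-\epsilon)}$, $k\in\mathbb Z$). Take $c=q^{2\alpha+1}$, $d=c^{-1}$, $s=-1$, and let $A=\{q^{2\alpha+1}<|\lambda|<1\}$. There is a holomorphic $\Theta:A\to H$ with $\hat Z\Theta(\lambda)=\lambda\Theta(\lambda)$ and $$(\Theta(\lambda),\Theta(\mu))=\frac{(b;q^2)_\infty}{(a;q^2)_\infty}\sum_{k=-\infty}^{\infty}\frac{(a;q^2)_k}{(b;q^2)_k}(\lambda\bar\mu)^k,\qquad a=-q^{-2(\alpha+\epsilon)},\quad b=-q^{2(\alpha+1-\epsilon)},$$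 the series (Ramanujan's ${}_1\Psi_1$) being absolutely convergent, such that $\theta:f\mapsto\big(\lambda\mapsto(f,\Theta(\bar\lambda))\big)$ takes values in functions holomorphic in $A$ and is a unitary isomorphism of $H$ onto $\mathcal H(A,\nu)$, where $$\nu=\sum_{k=0}^{2\alpha+1}(-1)^kq^{2k(\alpha+1-\epsilon)}\frac{(q^{-2(2\alpha+1)};q^2)_k}{(q^2;q^2)_k}\,\delta_{|\lambda|=q^k}.$$ -/

import Mathlib

open Complex Filter Topology MeasureTheory

noncomputable section

/-- A `*`-representation of `U_q su(1,1)` in a Hilbert space `H`: operators `E, F, K, K⁻¹` on a dense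
subspace `dom` satisfying the defining relations of `U_q sl(2)`, compatible with the involution
`K^* = K`, `E^* = -q K⁻¹ F` (equivalently `F^* = -q⁻¹ E K`). -/
structure UqSU11Rep (q : ℝ) (H : Type*) [NormedAddCommGroup H] [InnerProductSpace ℂ H] where
  dom : Submodule ℂ H
  dense_dom : Dense (dom : Set H)
  E : Module.End ℂ dom
  F : Module.End ℂ dom
  K : Module.End ℂ dom
  Kinv : Module.End ℂ dom
  K_mul_Kinv : K * Kinv = 1
  Kinv_mul_K : Kinv * K = 1
  K_mul_E : K * E = ((q : ℂ) ^ 2)⁻¹ • (E * K)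
  K_mul_F : K * F = ((q : ℂ) ^ 2) • (F * K)
  E_comm_F : E * F - F * E = ((q : ℂ)⁻¹ - q)⁻¹ • (K - Kinv)
  K_star : ∀ u v : dom, inner ℂ (K u : H) (v : H) = inner ℂ (u : H) (K v : H)
  E_star : ∀ u v : dom,
    inner ℂ (E u : H) (v : H) = inner ℂ (u : H) (((-(q : ℂ)) • (Kinv * F)) v : H)

namespace UqSU11Rep

variable {q : ℝ} {H : Type*} [NormedAddCommGroup H] [InnerProductSpace ℂ H]

/-- The quantum quadratic Casimir element
`½ (EF + FE) + (q⁻¹ + q) / (2 (q⁻¹ - q)²) (K - 2 + K⁻¹)`. -/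
def casimir (T : UqSU11Rep q H) : Module.End ℂ T.dom :=
  (2 : ℂ)⁻¹ • (T.E * T.F + T.F * T.E) +
    (((q : ℂ)⁻¹ + q) / (2 * ((q : ℂ)⁻¹ - q) ^ 2)) • (T.K - (2 : ℂ) • 1 + T.Kinv)

/-- Irreducibility: `dom` is a simple module. -/
def IsIrreducible (T : UqSU11Rep q H) : Prop :=
  Nontrivial T.dom ∧
    ∀ W : Submodule ℂ T.dom,
      (∀ w ∈ W, T.E w ∈ W ∧ T.F w ∈ W ∧ T.K w ∈ W ∧ T.Kinv w ∈ W) → W = ⊥ ∨ W = ⊤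

/-- The value `(q^l - q^{-l}) (q^{l+1} - q^{-l-1}) / (q⁻¹ - q)²` of the Casimir element at
spin `l`. -/
def casimirValue (q : ℝ) (l : ℂ) : ℂ :=
  ((q : ℂ) ^ l - (q : ℂ) ^ (-l)) * ((q : ℂ) ^ (l + 1) - (q : ℂ) ^ (-l - 1)) /
    ((q : ℂ)⁻¹ - q) ^ 2

/-- `T` is the holomorphic discrete series representation `T⁺_{l,ε}`: irreducible, of highest
weight `q^{-2l}`. (`E` multiplies `K`-eigenvalues by `q⁻² > 1`.) The eigenvalues of `K` are
then `q^{-2l+2k}`, `k = 0, 1, 2, …`, and the parity `ε` is `l` modulo `ℤ`. -/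
def IsHolomorphicDiscrete (T : UqSU11Rep q H) (l ε : ℝ) : Prop :=
  |ε| ≤ 1 / 2 ∧ (∃ n : ℤ, l - ε = n) ∧ T.IsIrreducible ∧
    ∃ v : T.dom, v ≠ 0 ∧ T.E v = 0 ∧ T.K v = ((q ^ (-2 * l) : ℝ) : ℂ) • v

/-- `T` is the strange series representation of spin `l = α + πi / (2 log q)`
(so that `q^{2l+1} = -q^{2α+1}`) and parity `ε`: irreducible, with that Casimir value, and with
eigenvalues of `K` of the form `q^{2(k-ε)}`, `k ∈ ℤ`. -/
def IsStrange (T : UqSU11Rep q H) (α ε : ℝ) : Prop :=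
  |ε| ≤ 1 / 2 ∧ T.IsIrreducible ∧
    (∀ u : T.dom,
      T.casimir u = casimirValue q ((α : ℂ) + Real.pi * Complex.I / (2 * Real.log q)) • u) ∧
    ∃ v : T.dom, v ≠ 0 ∧ T.K v = ((q ^ (-2 * ε) : ℝ) : ℂ) • v

/-- The generator `x` of the algebra of functions on the quantum hyperboloid `X_{c,d}`, `c d = 1`,
acting through the quantum moment map `K ↦ x / s`, where `s = (c d)^{1/2} = ±1`. -/
def x (T : UqSU11Rep q H) (s : ℝ) : Module.End ℂ T.dom := (s : ℂ) • T.K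

/-- The generator `y`, acting through the quantum moment map `E ↦ -(1 - q²)⁻¹ x⁻¹ y`. -/
def y (T : UqSU11Rep q H) (s : ℝ) : Module.End ℂ T.dom :=
  (-(1 - (q : ℂ) ^ 2)) • (T.x s * T.E)

/-- The generator `ζ = (q x - c)⁻¹ y` of the holomorphic quantum polarization. -/
def zeta (T : UqSU11Rep q H) (s c : ℝ) : Module.End ℂ T.dom :=
  Ring.inverse ((q : ℂ) • T.x s - (c : ℂ) • 1) * T.y s

/-- The closed operator in `H` defined by the normalized holomorphic coordinate
`(c / d)^{1/2} ζ = c ζ` (recall `c d = 1`). -/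
def zetaClosed (T : UqSU11Rep q H) (s c : ℝ) : H →ₗ.[ℂ] H :=
  LinearPMap.closure ⟨T.dom, T.dom.subtype ∘ₗ ((c : ℂ) • T.zeta s c)⟩

end UqSU11Rep

/-- `(a; t)_∞ = ∏_{k ≥ 0} (1 - a t^k)`. -/
def qPochInf (a t : ℂ) : ℂ := ∏' k : ℕ, (1 - a * t ^ k)

/-- `(a; t)_∞` for real arguments. -/
def qPochInfReal (a t : ℝ) : ℝ := ∏' k : ℕ, (1 - a * t ^ k)

/-- `(a; t)_β = (a; t)_∞ / (a t^β; t)_∞` for `t > 0`. -/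
def qPoch (a : ℂ) (t β : ℝ) : ℂ := qPochInf a t / qPochInf (a * ((t ^ β : ℝ) : ℂ)) t

/-- `(a; t)_k = ∏_{j < k} (1 - a t^j)` for a natural number `k`. -/
def qPochNat (a t : ℝ) (k : ℕ) : ℝ := ∏ j ∈ Finset.range k, (1 - a * t ^ j)

/-- The term `(a; t)_k / (b; t)_k x^k` of Ramanujan's series. -/
def psiTerm (a b : ℂ) (t : ℝ) (x : ℂ) (k : ℤ) : ℂ := qPoch a t k / qPoch b t k * x ^ k

/-- Ramanujan's bilateral series `₁Ψ₁(a; b; t, x)`. -/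
def ramanujanPsi (a b : ℂ) (t : ℝ) (x : ℂ) : ℂ := ∑' k : ℤ, psiTerm a b t x k

/-- The rotation-invariant probability measure on the circle `|λ| = r`. -/
def circleMeasure (r : ℝ) : Measure ℂ :=
  ((ENNReal.ofReal (2 * Real.pi))⁻¹ • volume.restrict (Set.Ioc 0 (2 * Real.pi))).map
    (circleMap 0 r)

/-- The measure `ν⁺_l` on the closed unit disc. -/
def discMeasure (q l : ℝ) : Measure ℂ :=
  if l < -1 / 2 then
    ENNReal.ofReal (1 - q ^ (-2 * (2 * l + 1))) • Measure.sum fun k : ℕ =>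
      ENNReal.ofReal (q ^ (2 * k) * qPochInfReal (q ^ (2 * (k + 1))) (q ^ 2) /
        qPochInfReal (q ^ (2 * ((k : ℝ) - 2 * l - 1))) (q ^ 2)) • circleMeasure (q ^ k)
  else circleMeasure 1

/-- The measure of the strange series on the closed annulus `q^N ≤ |λ| ≤ 1`, `N = 2α + 1`. -/
def annulusMeasure (q α ε : ℝ) (N : ℕ) : Measure ℂ :=
  ∑ k ∈ Finset.range (N + 1),
    ENNReal.ofReal ((-1) ^ k * q ^ (2 * (k : ℝ) * (α + 1 - ε)) *
      (qPochNat (q ^ (-2 * (2 * α + 1))) (q ^ 2) k / qPochNat (q ^ 2) (q ^ 2) k)) •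
      circleMeasure (q ^ k)

/-- Functions holomorphic in `D` and continuous in its closure. -/
def IsHolCont (D : Set ℂ) (g : ℂ → ℂ) : Prop :=
  DifferentiableOn ℂ g D ∧ ContinuousOn g (closure D)

/-- The classes in `L²(ν)` of functions holomorphic in `D` and continuous in its closure. -/
def holContL2 (D : Set ℂ) (ν : Measure ℂ) : Submodule ℂ (Lp ℂ 2 ν) where
  carrier := {u | ∃ g : ℂ → ℂ, IsHolCont D g ∧ u =ᵐ[ν] g}
  zero_mem' := ⟨fun _ => 0, ⟨differentiableOn_const _, continuousOn_const⟩, Lp.coeFn_zero _ _ _⟩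
  add_mem' := by
    rintro u v ⟨g, hg, hu⟩ ⟨h, hh, hv⟩
    exact ⟨g + h, ⟨hg.1.add hh.1, hg.2.add hh.2⟩, (Lp.coeFn_add u v).trans (hu.add hv)⟩
  smul_mem' := by
    rintro c u ⟨g, hg, hu⟩
    exact ⟨c • g, ⟨hg.1.const_smul c, hg.2.const_smul c⟩,
      (Lp.coeFn_smul c u).trans (hu.const_smul c)⟩

/-- The Hilbert space of functions holomorphic in `D` and continuous in its closure, with the
scalar product of `L²(ν)`: the completion, realized as a closed subspace of `L²(ν)`. -/
abbrev holHilbert (D : Set ℂ) (ν : Measure ℂ) : Submodule ℂ (Lp ℂ 2 ν) :=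
  (holContL2 D ν).topologicalClosure

/-- The element `u` of the completion is represented by the holomorphic function `f` in `D`:
they agree almost everywhere in `D`, and `u` is a limit in `L²(ν)` of functions holomorphic in `D`
and continuous in its closure that converge to `f` locally uniformly in `D`. (The second condition
fixes `u` on the part of the boundary of `D` that carries mass.) -/
def IsRepresentedBy (D : Set ℂ) (ν : Measure ℂ) (u : Lp ℂ 2 ν) (f : ℂ → ℂ) : Prop :=
  u =ᵐ[ν.restrict D] f ∧
    ∃ g : ℕ → ℂ → ℂ, (∀ n, IsHolCont D (g n)) ∧ TendstoLocallyUniformlyOn g f atTop D ∧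
      Tendsto (fun n => eLpNorm (fun z => g n z - u z) 2 ν) atTop (𝓝 0)

/-- The map `θ : f ↦ (λ ↦ (f, Θ(λ̄)))`; the scalar product `(f, g)`, linear in `f`, is
`inner ℂ g f`. -/
def thetaMap {H : Type*} [NormedAddCommGroup H] [InnerProductSpace ℂ H] (Θ : ℂ → H) (f : H) :
    ℂ → ℂ :=
  fun z => inner ℂ (Θ (starRingEnd ℂ z)) f

/-- `θ` is an isomorphism of Hilbert spaces of `H` onto the space of holomorphic functions in `D`
with the measure `ν`. -/
def IsHolomorphicRealization {H : Type*} [NormedAddCommGroup H] [InnerProductSpace ℂ H]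
    (Θ : ℂ → H) (D : Set ℂ) (ν : Measure ℂ) : Prop :=
  (∀ f : H, DifferentiableOn ℂ (thetaMap Θ f) D) ∧
    ∃ U : H ≃ₗᵢ[ℂ] holHilbert D ν,
      ∀ f : H, IsRepresentedBy D ν (U f : Lp ℂ 2 ν) (thetaMap Θ f)

end

/-! Both realizations come from one mechanism. The module has an orthogonal basis of `K`-weight
vectors `f i`, scaled so that the normalized coordinate acts as a backward shift: it sends `f (k +
1)` to `f k`, and in the highest weight case it kills `f 0`. Hence Θ(λ) = ∑ λ^k f_k is an
eigenvector with eigenvalue λ wherever the series converges, and (Θ(λ), Θ(μ)) = ∑ ‖f_k‖² (λμ̄)^k.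
The transform θ sends x to ∑ (x, f_k) λ^k, so it sends f_k to ‖f_k‖² λ^k. It is therefore unitary
exactly when the monomials λ^k form an orthogonal basis of the function space with squared norms
‖f_k‖⁻².

Orthogonality is automatic for a measure carried by concentric circles. Completeness is Cauchy's
theorem together with Parseval: a holomorphic function that is continuous up to the boundary has the
same Laurent coefficients on every circle carrying mass, so its L² norm is ∑ |c_n|² M_n, where M_n
is the squared norm of λ^n. What remains is a moment problem, ∑ w_k r_k^{2n} = ‖f_n‖⁻².

The relation `E^* = -q K⁻¹ F` gives a two-term recurrence for the norms. For the highest weight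
module, with Λ = q^{-2l}, ‖f_n‖² = (Λ²; q²)_n / (q²; q²)_n. For the strange series the Casimir
element determines `F E` on weight vectors, it never vanishes there, and ‖f_n‖⁻² = (a q^{2n}; q²)_N.
In both cases the q-binomial theorem `tsum_mul_tprod_eq_of_recurrence` evaluates the moments; in the
annulus it is a finite sum. In the disc it also sums the reproducing kernel.

The analytic half is `CoherentSystem.isHolomorphicRealization`, which pairs a `CircularSetting` (the
measure) with a `CoherentSystem` (the vectors). The algebraic half is `zeta_highestWeightFamily` and
`exists_basis_of_isStrange`; `IsWeightFamily.mem_graph_zetaClosed` carries the shift over to the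
closed operator. -/

noncomputable section

/-! ### Infinite q-products and the q-binomial theorem. -/

section QSeries

variable {𝕜 : Type*} [RCLike 𝕜]

theorem summable_norm_mul_pow {t : 𝕜} (ht : ‖t‖ < 1) (a : 𝕜) :
    Summable fun k : ℕ => ‖-(a * t ^ k)‖ := by
  simp only [norm_neg, norm_mul, norm_pow]
  exact (summable_geometric_of_lt_one (norm_nonneg _) ht).mul_left _

theorem multipliable_one_sub_mul_pow {t : 𝕜} (ht : ‖t‖ < 1) (a : 𝕜) :
    Multipliable fun k : ℕ => 1 - a * t ^ k := by
  simpa only [sub_eq_add_neg] using multipliable_one_add_of_summable (summable_norm_mul_pow ht a)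

theorem tprod_one_sub_mul_pow_ne_zero {t : 𝕜} (ht : ‖t‖ < 1) {a : 𝕜}
    (h : ∀ k : ℕ, 1 - a * t ^ k ≠ 0) : ∏' k : ℕ, (1 - a * t ^ k) ≠ 0 := by
  simpa only [sub_eq_add_neg] using tprod_one_add_ne_zero_of_summable
    (f := fun k : ℕ => -(a * t ^ k)) (by simpa only [sub_eq_add_neg] using h)
    (summable_norm_mul_pow ht a)

theorem tendsto_prod_one_sub_mul_pow {t : 𝕜} (ht : ‖t‖ < 1) (a : 𝕜) :
    Tendsto (fun n => ∏ k ∈ Finset.range n, (1 - a * t ^ k)) atTop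
      (𝓝 (∏' k : ℕ, (1 - a * t ^ k))) :=
  (multipliable_one_sub_mul_pow ht a).hasProd.tendsto_prod_nat

theorem tprod_one_sub_mul_pow_eq {t : 𝕜} (ht : ‖t‖ < 1) (a : 𝕜) (n : ℕ) :
    ∏' k : ℕ, (1 - a * t ^ k) =
      (∏ k ∈ Finset.range n, (1 - a * t ^ k)) * ∏' k : ℕ, (1 - a * t ^ n * t ^ k) := by
  rw [← Multipliable.prod_mul_tprod_nat_mul' (f := fun k : ℕ => 1 - a * t ^ k) (k := n)]
  · congr 1
    refine tprod_congr fun k => ?_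
    ring
  · refine (multipliable_one_sub_mul_pow ht (a * t ^ n)).congr fun k => ?_
    ring

/-- The `q`-binomial theorem. -/
theorem tsum_mul_tprod_eq_of_recurrence {t B z : 𝕜} (ht : ‖t‖ < 1) {c : ℕ → 𝕜} (h0 : c 0 = 1)
    (hc : ∀ k, c (k + 1) * (1 - t ^ (k + 1)) = c k * (1 - B * t ^ k))
    (hs : Summable fun k => ‖c k * z ^ k‖) :
    (∑' k, c k * z ^ k) * ∏' k : ℕ, (1 - z * t ^ k) = ∏' k : ℕ, (1 - B * z * t ^ k) := by
  have hsn : ∀ n : ℕ, Summable fun k => c k * (z * t ^ n) ^ k := fun n => by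
    refine Summable.of_norm_bounded hs fun k => ?_
    rw [mul_pow, ← mul_assoc, norm_mul]
    refine mul_le_of_le_one_right (norm_nonneg _) ?_
    rw [norm_pow, norm_pow]
    exact pow_le_one₀ (by positivity) (pow_le_one₀ (norm_nonneg _) ht.le)
  -- With φ(w) = ∑ c_k w^k, the recurrence for c is the functional equation (1 - w) φ(w) = (1 - B w)
  -- φ(t w).
  have hstep : ∀ n : ℕ, (∑' k, c k * (z * t ^ n) ^ k) * (1 - z * t ^ n) =
      (1 - B * z * t ^ n) * ∑' k, c k * (z * t ^ (n + 1)) ^ k := by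
    intro n
    set w := z * t ^ n with hw
    have hw' : z * t ^ (n + 1) = w * t := by rw [hw]; ring
    have hB : B * z * t ^ n = B * w := by rw [hw]; ring
    have s1 : Summable fun k => c k * w ^ k := hsn n
    have s2 : Summable fun k => c k * (w * t) ^ k := hw' ▸ hsn (n + 1)
    rw [hw', hB]
    have e1 := s1.tsum_eq_zero_add
    have e2 := s2.tsum_eq_zero_add
    have s1' := (summable_nat_add_iff 1).2 s1
    have s2' := (summable_nat_add_iff 1).2 s2
    have key : ∑' k, c (k + 1) * w ^ (k + 1) - ∑' k, c (k + 1) * (w * t) ^ (k + 1) =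
        w * ∑' k, c k * w ^ k - B * w * ∑' k, c k * (w * t) ^ k := by
      rw [← s1'.tsum_sub s2', ← tsum_mul_left, ← tsum_mul_left,
        ← (s1.mul_left _).tsum_sub (s2.mul_left _)]
      refine tsum_congr fun k => ?_
      linear_combination (w ^ (k + 1)) * hc k
    simp only [pow_zero, mul_one] at e1 e2
    linear_combination e1 - e2 + key
  have hiter : ∀ n : ℕ, (∑' k, c k * z ^ k) * ∏ k ∈ Finset.range n, (1 - z * t ^ k) =
      (∏ k ∈ Finset.range n, (1 - B * z * t ^ k)) * ∑' k, c k * (z * t ^ n) ^ k := by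
    intro n
    induction n with
    | zero => simp
    | succ n ih =>
      rw [Finset.prod_range_succ, Finset.prod_range_succ]
      linear_combination (1 - z * t ^ n) * ih +
        (∏ k ∈ Finset.range n, (1 - B * z * t ^ k)) * hstep n
  -- After n iterations the remaining factor is φ(z t^n), which tends to φ(0) = c 0 = 1.
  have hlim : Tendsto (fun n : ℕ => ∑' k, c k * (z * t ^ n) ^ k) atTop (𝓝 1) := by
    have h1 : ∑' k, c k * (0 : 𝕜) ^ k = 1 := by
      rw [tsum_eq_single 0 fun k hk => by simp [hk]]
      simp [h0]
    rw [← h1]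
    refine tendsto_tsum_of_dominated_convergence hs (fun k => ?_) (Eventually.of_forall fun n k => ?_)
    · have h2 : Tendsto (fun n : ℕ => z * t ^ n) atTop (𝓝 (z * 0)) :=
        (tendsto_pow_atTop_nhds_zero_of_norm_lt_one ht).const_mul z
      rw [mul_zero] at h2
      exact (h2.pow k).const_mul (c k)
    · rw [mul_pow, ← mul_assoc, norm_mul]
      refine mul_le_of_le_one_right (norm_nonneg _) ?_
      rw [norm_pow, norm_pow]
      exact pow_le_one₀ (by positivity) (pow_le_one₀ (norm_nonneg _) ht.le)
  have l1 := (tendsto_prod_one_sub_mul_pow ht z).const_mul (∑' k, c k * z ^ k)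
  have l2 := (tendsto_prod_one_sub_mul_pow ht (B * z)).mul hlim
  rw [mul_one] at l2
  exact tendsto_nhds_unique (l1.congr hiter) l2

end QSeries

/-! ### Laurent coefficients and rotation-invariant measures on circles. -/

section Circle

open scoped ENNReal

theorem measurable_circleMap_zero (r : ℝ) : Measurable (circleMap 0 r) :=
  (continuous_circleMap 0 r).measurable

theorem ae_circleMeasure_norm_eq {r : ℝ} (hr : 0 ≤ r) : ∀ᵐ z ∂circleMeasure r, ‖z‖ = r := by
  rw [circleMeasure, ae_map_iff (measurable_circleMap_zero r).aemeasurable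
    (measurableSet_eq_fun measurable_norm measurable_const)]
  refine Eventually.of_forall fun θ => ?_
  simp [abs_of_nonneg hr]

theorem lintegral_circleMeasure {r : ℝ} {f : ℂ → ℝ≥0∞} (hf : AEMeasurable f (circleMeasure r)) :
    ∫⁻ z, f z ∂circleMeasure r = (ENNReal.ofReal (2 * Real.pi))⁻¹ *
      ∫⁻ θ in Set.Ioc 0 (2 * Real.pi), f (circleMap 0 r θ) := by
  rw [circleMeasure] at hf ⊢
  rw [lintegral_map' hf (measurable_circleMap_zero r).aemeasurable, lintegral_smul_measure,
    smul_eq_mul]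

theorem integral_circleMeasure {r : ℝ} {f : ℂ → ℂ}
    (hf : AEStronglyMeasurable f (circleMeasure r)) :
    ∫ z, f z ∂circleMeasure r = (2 * Real.pi)⁻¹ •
      ∫ θ in (0 : ℝ)..(2 * Real.pi), f (circleMap 0 r θ) := by
  rw [circleMeasure] at hf ⊢
  rw [integral_map (measurable_circleMap_zero r).aemeasurable hf, integral_smul_measure,
    intervalIntegral.integral_of_le Real.two_pi_pos.le, ENNReal.toReal_inv,
    ENNReal.toReal_ofReal Real.two_pi_pos.le]

theorem ContinuousOn.aestronglyMeasurable_circleMeasure {r : ℝ} (hr : 0 ≤ r) {g : ℂ → ℂ}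
    (hg : ContinuousOn g (Metric.sphere 0 r)) : AEStronglyMeasurable g (circleMeasure r) := by
  have h := hg.aestronglyMeasurable (μ := circleMeasure r) Metric.isClosed_sphere.measurableSet
  rwa [Measure.restrict_eq_self_of_ae_mem] at h
  filter_upwards [ae_circleMeasure_norm_eq hr] with z hz
  simpa using hz

/-- The `n`-th Laurent coefficient of a function on the circle of radius `r`. -/
def laurentCoeff (g : ℂ → ℂ) (r : ℝ) (n : ℤ) : ℂ :=
  (2 * Real.pi * I)⁻¹ * ∮ z in C(0, r), z ^ (-n - 1) * g z

/-- The substitution dz = i z dθ turns the contour integral into a Fourier integral, so Parseval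
becomes available for Laurent coefficients. -/
theorem fourierCoeffOn_comp_circleMap {r : ℝ} (hr : 0 < r) (g : ℂ → ℂ) (n : ℤ) :
    fourierCoeffOn Real.two_pi_pos (fun θ => g (circleMap 0 r θ)) n =
      (r : ℂ) ^ n * laurentCoeff g r n := by
  have hr' : (r : ℂ) ≠ 0 := by exact_mod_cast hr.ne'
  have hpi : (Real.pi : ℂ) ≠ 0 := by exact_mod_cast Real.pi_ne_zero
  rw [fourierCoeffOn_eq_integral, laurentCoeff, circleIntegral]
  have : ∀ θ : ℝ, deriv (circleMap 0 r) θ • (circleMap 0 r θ ^ (-n - 1) * g (circleMap 0 r θ)) =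
      (I * (r : ℂ) ^ (-n)) * ((fourier (-n)) (θ : AddCircle (2 * Real.pi - 0)) •
        g (circleMap 0 r θ)) := by
    intro θ
    have h0 : circleMap 0 r θ ≠ 0 := circleMap_ne_center hr.ne'
    have h1 : circleMap 0 r θ ^ (-n) =
        (r : ℂ) ^ (-n) * fourier (-n) (θ : AddCircle (2 * Real.pi - 0)) := by
      rw [circleMap_zero, mul_zpow, fourier_coe_apply, ← Complex.exp_int_mul]
      congr 2
      push_cast
      field_simp
      ring
    rw [deriv_circleMap, zpow_sub₀ h0, zpow_one, h1, smul_eq_mul, smul_eq_mul]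
    field_simp
  simp_rw [this]
  rw [intervalIntegral.integral_const_mul, zpow_neg]
  have hn : (r : ℂ) ^ n ≠ 0 := zpow_ne_zero _ hr'
  rw [Complex.real_smul]
  push_cast
  rw [sub_zero]
  field_simp

theorem integral_conj_zpow_mul_circleMeasure {r : ℝ} (hr : 0 < r) {g : ℂ → ℂ}
    (hg : ContinuousOn g (Metric.sphere 0 r)) (n : ℤ) :
    ∫ z, starRingEnd ℂ (z ^ n) * g z ∂circleMeasure r =
      laurentCoeff g r n * ((r ^ (2 * n) : ℝ) : ℂ) := by
  have hr' : (r : ℂ) ≠ 0 := by exact_mod_cast hr.ne'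
  have hpi : (Real.pi : ℂ) ≠ 0 := by exact_mod_cast Real.pi_ne_zero
  have hm : ContinuousOn (fun z : ℂ => starRingEnd ℂ (z ^ n)) (Metric.sphere 0 r) := by
    refine Complex.continuous_conj.comp_continuousOn fun z hz => ?_
    refine (continuousAt_zpow₀ z n (Or.inl ?_)).continuousWithinAt
    rintro rfl
    simp at hz
    exact hr.ne hz
  rw [integral_circleMeasure ((hm.fun_mul hg).aestronglyMeasurable_circleMeasure hr.le)]
  have h1 := fourierCoeffOn_comp_circleMap hr g n
  rw [fourierCoeffOn_eq_integral] at h1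
  have h2 : ∀ θ : ℝ, starRingEnd ℂ (circleMap 0 r θ ^ n) * g (circleMap 0 r θ) =
      (r : ℂ) ^ n * ((fourier (-n)) (θ : AddCircle (2 * Real.pi - 0)) •
        g (circleMap 0 r θ)) := by
    intro θ
    rw [circleMap_zero, mul_zpow, fourier_coe_apply, map_mul, map_zpow₀, map_zpow₀,
      Complex.conj_ofReal, ← Complex.exp_conj, ← Complex.exp_int_mul, smul_eq_mul, ← mul_assoc]
    congr 3
    simp only [map_mul, Complex.conj_ofReal, Complex.conj_I]
    push_cast
    field_simp
    ring
  simp_rw [h2]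
  rw [intervalIntegral.integral_const_mul]
  rw [Complex.real_smul] at h1 ⊢
  have h3 : ((r ^ (2 * n) : ℝ) : ℂ) = (r : ℂ) ^ n * (r : ℂ) ^ n := by
    rw [two_mul, zpow_add₀ hr.ne']
    push_cast
    rfl
  rw [h3, mul_left_comm]
  rw [one_div, sub_zero] at h1
  rw [sub_zero, h1]
  ring

/-- Parseval on one circle, with values in `ℝ≥0∞` so that infinitely many circles can later be
summed by Tonelli without integrability questions. -/
theorem lintegral_sq_circleMeasure {r : ℝ} (hr : 0 < r) {g : ℂ → ℂ}
    (hg : ContinuousOn g (Metric.sphere 0 r)) :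
    ∫⁻ z, ‖g z‖ₑ ^ 2 ∂circleMeasure r =
      ∑' n : ℤ, ENNReal.ofReal (‖laurentCoeff g r n‖ ^ 2 * r ^ (2 * n)) := by
  have hm := hg.aestronglyMeasurable_circleMeasure hr.le
  have hc : Continuous fun θ => g (circleMap 0 r θ) :=
    hg.comp_continuous (continuous_circleMap 0 r) fun θ => circleMap_mem_sphere 0 hr.le θ
  have hL : MemLp (fun θ => g (circleMap 0 r θ)) 2
      (volume.restrict (Set.Ioc 0 (2 * Real.pi))) := by
    have : IsFiniteMeasure (volume.restrict (Set.Ioc 0 (2 * Real.pi))) := inferInstance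
    have hK := (isCompact_Icc (a := (0 : ℝ)) (b := 2 * Real.pi)).exists_bound_of_continuousOn
      hc.continuousOn
    obtain ⟨M, hM⟩ := hK
    refine MemLp.of_bound hc.aestronglyMeasurable M ?_
    filter_upwards [ae_restrict_mem measurableSet_Ioc] with θ hθ
    exact hM θ (Set.Ioc_subset_Icc_self hθ)
  have hS := hasSum_sq_fourierCoeffOn Real.two_pi_pos hL
  simp_rw [fourierCoeffOn_comp_circleMap hr] at hS
  have e1 : ∀ n : ℤ, ‖(r : ℂ) ^ n * laurentCoeff g r n‖ ^ 2 =
      ‖laurentCoeff g r n‖ ^ 2 * r ^ (2 * n) := by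
    intro n
    rw [norm_mul, norm_zpow, Complex.norm_real, Real.norm_of_nonneg hr.le, two_mul,
      zpow_add₀ hr.ne']
    ring
  simp_rw [e1] at hS
  have hpos : ∀ n : ℤ, 0 ≤ ‖laurentCoeff g r n‖ ^ 2 * r ^ (2 * n) := fun n => by positivity
  rw [← ENNReal.ofReal_tsum_of_nonneg hpos hS.summable, hS.tsum_eq,
    lintegral_circleMeasure (hm.enorm.pow_const 2), smul_eq_mul, sub_zero,
    ENNReal.ofReal_mul (p := (2 * Real.pi)⁻¹) (by positivity),
    ENNReal.ofReal_inv_of_pos Real.two_pi_pos, intervalIntegral.integral_of_le Real.two_pi_pos.le,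
    ofReal_integral_eq_lintegral_ofReal]
  · congr 1
    refine lintegral_congr fun θ => ?_
    rw [ENNReal.ofReal_pow (norm_nonneg _), ofReal_norm]
  · exact hL.integrable_norm_pow (by norm_num)
  · exact Eventually.of_forall fun θ => by positivity

/-- Cauchy's theorem for z^(-n-1) g(z) in the annulus between the two circles. -/
theorem laurentCoeff_eq_of_annulus {r : ℝ} (hr : 0 < r) (hr1 : r ≤ 1) {g : ℂ → ℂ}
    (hg : ContinuousOn g (Metric.closedBall 0 1 \ Metric.ball 0 r))
    (hd : DifferentiableOn ℂ g (Metric.ball 0 1 \ Metric.closedBall 0 r)) (n : ℤ) :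
    laurentCoeff g r n = laurentCoeff g 1 n := by
  have hopen : IsOpen (Metric.ball (0 : ℂ) 1 \ Metric.closedBall 0 r) :=
    Metric.isOpen_ball.sdiff Metric.isClosed_closedBall
  rw [laurentCoeff, laurentCoeff,
    Complex.circleIntegral_eq_of_differentiable_on_annulus_off_countable hr hr1
      Set.countable_empty]
  · refine ContinuousOn.mul (fun z hz => ?_) hg
    refine (continuousAt_zpow₀ z _ (Or.inl ?_)).continuousWithinAt
    rintro rfl
    exact hz.2 (by simpa using hr)
  · intro z hz
    refine DifferentiableAt.mul (differentiableAt_zpow.2 (Or.inl ?_))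
      (hd.differentiableAt (hopen.mem_nhds hz.1))
    rintro rfl
    exact hz.1.2 (by simpa using hr.le)

/-- For n < 0 the exponent -n - 1 is nonnegative, so the integrand is holomorphic in the whole disc.
-/
theorem laurentCoeff_eq_zero_of_neg {g : ℂ → ℂ} (hg : ContinuousOn g (Metric.closedBall 0 1))
    (hd : DifferentiableOn ℂ g (Metric.ball 0 1)) {n : ℤ} (hn : n < 0) :
    laurentCoeff g 1 n = 0 := by
  obtain ⟨k, hk⟩ : ∃ k : ℕ, -n - 1 = k := ⟨(-n - 1).toNat, by omega⟩
  rw [laurentCoeff, hk,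
    Complex.circleIntegral_eq_zero_of_differentiable_on_off_countable zero_le_one
      Set.countable_empty, mul_zero]
  · simp only [zpow_natCast]
    exact (continuous_pow k).continuousOn.mul hg
  · intro z hz
    simp only [zpow_natCast]
    exact (differentiableAt_pow k).mul (hd.differentiableAt (Metric.isOpen_ball.mem_nhds hz.1))

theorem laurentCoeff_zpow {r : ℝ} (hr : 0 < r) (m n : ℤ) :
    laurentCoeff (fun z => z ^ m) r n = if n = m then 1 else 0 := by
  have hpi : (Real.pi : ℂ) ≠ 0 := by exact_mod_cast Real.pi_ne_zero
  have h : (∮ z in C(0, r), z ^ (-n - 1) * z ^ m) = ∮ z in C(0, r), (z - 0) ^ (m - n - 1) := by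
    refine circleIntegral.integral_congr hr.le fun z hz => ?_
    have hz0 : z ≠ 0 := by
      rintro rfl
      simp at hz
      exact hr.ne hz
    simp only [sub_zero]
    rw [← zpow_add₀ hz0]
    congr 1
    ring
  rw [laurentCoeff, h]
  split_ifs with hnm
  · subst hnm
    simp only [sub_self, zero_sub, zpow_neg, zpow_one]
    have := circleIntegral.integral_sub_center_inv (0 : ℂ) hr.ne'
    rw [this]
    field_simp
  · rw [circleIntegral.integral_sub_zpow_of_ne (by omega), mul_zero]

end Circle

/-! ### Monomial bases of spaces of holomorphic functions. -/

/-- Equality in Bessel's inequality: the squared distance from x to its partial expansion is ‖x‖²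
minus the partial sum of squared coefficients, and this tends to zero. -/
theorem Orthonormal.mem_topologicalClosure_span_of_hasSum {𝕜 E ι : Type*} [RCLike 𝕜]
    [NormedAddCommGroup E] [InnerProductSpace 𝕜 E] {v : ι → E} (hv : Orthonormal 𝕜 v) {x : E}
    (h : HasSum (fun i => ‖inner 𝕜 (v i) x‖ ^ 2) (‖x‖ ^ 2)) :
    x ∈ (Submodule.span 𝕜 (Set.range v)).topologicalClosure := by
  classical
  have key : ∀ s : Finset ι, ‖x - ∑ i ∈ s, inner 𝕜 (v i) x • v i‖ ^ 2 =
      ‖x‖ ^ 2 - ∑ i ∈ s, ‖inner 𝕜 (v i) x‖ ^ 2 := by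
    intro s
    have h1 : inner 𝕜 x (∑ i ∈ s, inner 𝕜 (v i) x • v i) =
        ((∑ i ∈ s, ‖inner 𝕜 (v i) x‖ ^ 2 : ℝ) : 𝕜) := by
      rw [inner_sum]
      push_cast
      refine Finset.sum_congr rfl fun i _ => ?_
      rw [inner_smul_right, ← inner_conj_symm x, RCLike.mul_conj]
    have h2 : ‖∑ i ∈ s, inner 𝕜 (v i) x • v i‖ ^ 2 = ∑ i ∈ s, ‖inner 𝕜 (v i) x‖ ^ 2 := by
      rw [← RCLike.ofReal_inj (K := 𝕜)]
      push_cast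
      rw [← inner_self_eq_norm_sq_to_K, hv.inner_sum]
      refine Finset.sum_congr rfl fun i _ => ?_
      rw [RCLike.conj_mul]
    rw [norm_sub_sq (𝕜 := 𝕜), h1, h2, RCLike.ofReal_re]
    ring
  have hlim : Tendsto (fun s : Finset ι => ∑ i ∈ s, inner 𝕜 (v i) x • v i) atTop (𝓝 x) := by
    rw [tendsto_iff_norm_sub_tendsto_zero]
    have h1 : Tendsto (fun s : Finset ι => ‖x - ∑ i ∈ s, inner 𝕜 (v i) x • v i‖ ^ 2) atTop
        (𝓝 0) := by
      simp_rw [key]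
      have h2 : Tendsto (fun s : Finset ι => ∑ i ∈ s, ‖inner 𝕜 (v i) x‖ ^ 2) atTop
          (𝓝 (‖x‖ ^ 2)) := h
      have h3 := (tendsto_const_nhds (x := ‖x‖ ^ 2)).sub h2
      rwa [sub_self] at h3
    have h2 := h1.sqrt
    simp only [Real.sqrt_sq (norm_nonneg _), Real.sqrt_zero] at h2
    simpa only [norm_sub_rev] using h2
  refine mem_closure_of_tendsto hlim (Eventually.of_forall fun s => ?_)
  exact Submodule.sum_mem _ fun i _ => Submodule.smul_mem _ _
    (Submodule.subset_span (Set.mem_range_self i))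

theorem IsHolCont.sum {D : Set ℂ} {ι : Type*} (s : Finset ι) {g : ι → ℂ → ℂ}
    (hg : ∀ i ∈ s, IsHolCont D (g i)) : IsHolCont D fun z => ∑ i ∈ s, g i z :=
  ⟨DifferentiableOn.fun_sum fun i hi => (hg i hi).1,
    continuousOn_finsetSum _ fun i hi => (hg i hi).2⟩

/-- A measure which is a sum of rotation-invariant measures on circles in the closure of a domain,
with respect to which the holomorphic functions in the domain are expanded into the monomials
`z ^ m i`, of norm `(M i) ^ (1 / 2)`. -/
structure CircularSetting {ι : Type*} (D : Set ℂ) (ν : Measure ℂ) (m : ι → ℤ) (r w : ℕ → ℝ)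
    (M : ι → ℝ) : Prop where
  isOpen : IsOpen D
  conj_mem : ∀ z ∈ D, starRingEnd ℂ z ∈ D
  r_pos : ∀ k, 0 < r k
  w_nonneg : ∀ k, 0 ≤ w k
  measure_eq : ν = Measure.sum fun k => ENNReal.ofReal (w k) • circleMeasure (r k)
  injective : Function.Injective m
  M_pos : ∀ i, 0 < M i
  moment : ∀ i, HasSum (fun k => w k * r k ^ (2 * m i)) (M i)
  sphere_subset : ∀ k, w k ≠ 0 → Metric.sphere 0 (r k) ⊆ closure D
  isHolCont_zpow : ∀ i, IsHolCont D fun z => z ^ m i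
  coeff : ∀ g, IsHolCont D g → ∃ c : ι → ℂ, ∀ k, w k ≠ 0 →
    (∀ i, laurentCoeff g (r k) (m i) = c i) ∧
      ∀ n, n ∉ Set.range m → laurentCoeff g (r k) n = 0

namespace CircularSetting

variable {ι : Type*} {D : Set ℂ} {ν : Measure ℂ} {m : ι → ℤ} {r w : ℕ → ℝ} {M : ι → ℝ}

/-- Circles of weight zero may lie outside the closure of D, as those inside the hole of an annulus
do; nothing is known of g there, but they contribute the zero measure. -/
theorem aestronglyMeasurable (S : CircularSetting D ν m r w M) {g : ℂ → ℂ} (hg : IsHolCont D g) :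
    AEStronglyMeasurable g ν := by
  rw [S.measure_eq]
  refine AEStronglyMeasurable.sum_measure fun k => ?_
  by_cases hk : w k = 0
  · simp [hk]
  · exact ((hg.2.mono (S.sphere_subset k hk)).aestronglyMeasurable_circleMeasure
      (S.r_pos k).le).smul_measure _

/-- Parseval on each circle, then Tonelli. As c does not depend on the circle, the inner sum over
circles is the moment `M i`. -/
theorem lintegral_sq (S : CircularSetting D ν m r w M) {g : ℂ → ℂ} (hg : IsHolCont D g)
    {c : ι → ℂ} (hc : ∀ k, w k ≠ 0 → (∀ i, laurentCoeff g (r k) (m i) = c i) ∧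
      ∀ n, n ∉ Set.range m → laurentCoeff g (r k) n = 0) :
    ∫⁻ z, ‖g z‖ₑ ^ 2 ∂ν = ∑' i, ENNReal.ofReal (‖c i‖ ^ 2 * M i) := by
  rw [S.measure_eq, lintegral_sum_measure]
  have h1 : ∀ k, ∫⁻ z, ‖g z‖ₑ ^ 2 ∂(ENNReal.ofReal (w k) • circleMeasure (r k)) =
      ∑' i, ENNReal.ofReal (‖c i‖ ^ 2 * (w k * r k ^ (2 * m i))) := by
    intro k
    have hrk := S.r_pos k
    rw [lintegral_smul_measure]
    by_cases hk : w k = 0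
    · simp [hk]
    · rw [lintegral_sq_circleMeasure hrk (hg.2.mono (S.sphere_subset k hk)),
        ← S.injective.tsum_eq, smul_eq_mul, ← ENNReal.tsum_mul_left]
      · refine tsum_congr fun i => ?_
        rw [(hc k hk).1 i, ← ENNReal.ofReal_mul (S.w_nonneg k)]
        congr 1
        ring
      · intro n hn
        by_contra hcon
        apply hn
        simp [(hc k hk).2 n hcon]
  simp_rw [h1]
  rw [ENNReal.tsum_comm]
  refine tsum_congr fun i => ?_
  have h2 := (S.moment i).mul_left (‖c i‖ ^ 2)
  rw [← h2.tsum_eq, ENNReal.ofReal_tsum_of_nonneg _ h2.summable]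
  intro k
  have := S.w_nonneg k
  have := S.r_pos k
  positivity

open scoped Classical in
theorem laurentCoeff_zpow_comp (S : CircularSetting D ν m r w M) (j : ι) (k : ℕ) (_ : w k ≠ 0) :
    (∀ i, laurentCoeff (fun z => z ^ m j) (r k) (m i) = if i = j then 1 else 0) ∧
      ∀ n, n ∉ Set.range m → laurentCoeff (fun z => z ^ m j) (r k) n = 0 := by
  refine ⟨fun i => ?_, fun n hn => ?_⟩
  · rw [laurentCoeff_zpow (S.r_pos k)]
    simp [S.injective.eq_iff]
  · rw [laurentCoeff_zpow (S.r_pos k), if_neg]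
    rintro rfl
    exact hn ⟨j, rfl⟩

theorem memLp_of_lintegral_sq_lt_top (S : CircularSetting D ν m r w M) {g : ℂ → ℂ} (hg : IsHolCont D g)
    (h : ∫⁻ z, ‖g z‖ₑ ^ 2 ∂ν < ⊤) : MemLp g 2 ν := by
  refine ⟨S.aestronglyMeasurable hg, ?_⟩
  rw [eLpNorm_lt_top_iff_lintegral_rpow_enorm_lt_top (by norm_num) (by norm_num)]
  simpa using h

theorem memLp_zpow (S : CircularSetting D ν m r w M) (i : ι) : MemLp (fun z => z ^ m i) 2 ν := by
  classical
  refine S.memLp_of_lintegral_sq_lt_top (S.isHolCont_zpow i) ?_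
  rw [S.lintegral_sq (S.isHolCont_zpow i) (S.laurentCoeff_zpow_comp i), tsum_eq_single i]
  · exact ENNReal.ofReal_lt_top
  · intro j hj
    simp [hj]

theorem integral_conj_zpow_mul (S : CircularSetting D ν m r w M) {g : ℂ → ℂ}
    (hg : IsHolCont D g) (hg2 : MemLp g 2 ν) {c : ι → ℂ}
    (hc : ∀ k, w k ≠ 0 → (∀ i, laurentCoeff g (r k) (m i) = c i) ∧
      ∀ n, n ∉ Set.range m → laurentCoeff g (r k) n = 0) (i : ι) :
    ∫ z, starRingEnd ℂ (z ^ m i) * g z ∂ν = c i * M i := by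
  have hint : Integrable (fun z => starRingEnd ℂ (z ^ m i) * g z) ν :=
    (MemLp.star (S.memLp_zpow i)).integrable_mul hg2
  rw [S.measure_eq] at hint ⊢
  have h1 := hasSum_integral_measure hint
  have h2 : HasSum (fun k => c i * ((w k * r k ^ (2 * m i) : ℝ) : ℂ)) (c i * (M i : ℂ)) :=
    (Complex.hasSum_ofReal.2 (S.moment i)).mul_left _
  refine h1.unique (h2.congr_fun fun k => ?_)
  rw [integral_smul_measure, ENNReal.toReal_ofReal (S.w_nonneg k)]
  by_cases hk : w k = 0
  · simp [hk]
  · rw [integral_conj_zpow_mul_circleMeasure (S.r_pos k) (hg.2.mono (S.sphere_subset k hk)),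
      (hc k hk).1 i, Complex.real_smul]
    push_cast
    ring

/-- The monomial `z ^ m i` in `L²(ν)`. -/
def monomial (S : CircularSetting D ν m r w M) (i : ι) : Lp ℂ 2 ν := (S.memLp_zpow i).toLp

theorem inner_monomial (S : CircularSetting D ν m r w M) {g : ℂ → ℂ} (hg : IsHolCont D g)
    {u : Lp ℂ 2 ν} (hu : u =ᵐ[ν] g) {c : ι → ℂ}
    (hc : ∀ k, w k ≠ 0 → (∀ i, laurentCoeff g (r k) (m i) = c i) ∧
      ∀ n, n ∉ Set.range m → laurentCoeff g (r k) n = 0) (i : ι) :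
    inner ℂ (S.monomial i) u = c i * M i := by
  rw [L2.inner_def, ← S.integral_conj_zpow_mul hg ((memLp_congr_ae hu).1 (Lp.memLp u)) hc i]
  refine integral_congr_ae ?_
  filter_upwards [hu, (S.memLp_zpow i).coeFn_toLp] with z h1 h2
  rw [monomial, h1, h2]
  simp [RCLike.inner_apply, mul_comm]

open scoped Classical in
theorem inner_monomial_monomial (S : CircularSetting D ν m r w M) (i j : ι) :
    inner ℂ (S.monomial i) (S.monomial j) = if i = j then (M j : ℂ) else 0 := by
  rw [S.inner_monomial (S.isHolCont_zpow j) (u := S.monomial j) (S.memLp_zpow j).coeFn_toLp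
    (S.laurentCoeff_zpow_comp j)]
  split_ifs with h
  · rw [h, one_mul]
  · rw [zero_mul]

theorem coeFn_sum_monomial (S : CircularSetting D ν m r w M) (a : ι → ℂ) (s : Finset ι) :
    (∑ i ∈ s, a i • S.monomial i : Lp ℂ 2 ν) =ᵐ[ν] fun z => ∑ i ∈ s, a i * z ^ m i := by
  classical
  induction s using Finset.induction_on with
  | empty => exact Lp.coeFn_zero ℂ 2 ν
  | insert i s hi ih =>
    rw [Finset.sum_insert hi]
    filter_upwards [ih, Lp.coeFn_add (a i • S.monomial i) (∑ i ∈ s, a i • S.monomial i),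
      Lp.coeFn_smul (a i) (S.monomial i), (S.memLp_zpow i).coeFn_toLp] with z h1 h2 h3 h4
    rw [h2, Pi.add_apply, h1, h3, Pi.smul_apply, monomial, h4, Finset.sum_insert hi, smul_eq_mul]

/-- The normalized monomials in `L²(ν)`. -/
def unitMonomial (S : CircularSetting D ν m r w M) (i : ι) : Lp ℂ 2 ν :=
  ((√(M i))⁻¹ : ℂ) • S.monomial i

theorem orthonormal_unitMonomial (S : CircularSetting D ν m r w M) :
    Orthonormal ℂ S.unitMonomial := by
  classical
  rw [orthonormal_iff_ite]
  intro i j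
  rw [unitMonomial, unitMonomial, inner_smul_left, inner_smul_right, S.inner_monomial_monomial]
  split_ifs with h
  · subst h
    have h1 : (√(M i) : ℂ) * √(M i) = M i := by
      exact_mod_cast Real.mul_self_sqrt (S.M_pos i).le
    have h2 : (√(M i) : ℂ) ≠ 0 := by
      exact_mod_cast (Real.sqrt_pos.2 (S.M_pos i)).ne'
    rw [← h1, map_inv₀, Complex.conj_ofReal]
    field_simp
  · simp

theorem monomial_mem (S : CircularSetting D ν m r w M) (i : ι) :
    S.monomial i ∈ holContL2 D ν :=
  ⟨_, S.isHolCont_zpow i, (S.memLp_zpow i).coeFn_toLp⟩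

/-- Completeness of the monomials: the squared coefficients of g in the unit monomials are ‖c i‖² `M
i`, and by `lintegral_sq` they add up to the whole of ‖g‖². -/
theorem holContL2_le (S : CircularSetting D ν m r w M) :
    holContL2 D ν ≤ (Submodule.span ℂ (Set.range S.unitMonomial)).topologicalClosure := by
  rintro u ⟨g, hg, hu⟩
  obtain ⟨c, hc⟩ := S.coeff g hg
  refine S.orthonormal_unitMonomial.mem_topologicalClosure_span_of_hasSum ?_
  have h1 : ∀ i, ‖inner ℂ (S.unitMonomial i) u‖ ^ 2 = ‖c i‖ ^ 2 * M i := by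
    intro i
    have h2 : √(M i) ≠ 0 := (Real.sqrt_pos.2 (S.M_pos i)).ne'
    have h3 : ‖(√(M i) : ℂ)‖ = √(M i) := by
      rw [Complex.norm_real, Real.norm_of_nonneg (Real.sqrt_nonneg _)]
    have h4 : ‖(M i : ℂ)‖ = √(M i) * √(M i) := by
      rw [Complex.norm_real, Real.norm_of_nonneg (S.M_pos i).le, Real.mul_self_sqrt (S.M_pos i).le]
    rw [unitMonomial, inner_smul_left, S.inner_monomial hg hu hc, norm_mul, norm_mul,
      RCLike.norm_conj, norm_inv, h3, h4]
    nth_rewrite 4 [← Real.mul_self_sqrt (S.M_pos i).le]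
    field_simp
  simp_rw [h1]
  have h2 : ENNReal.ofReal (‖u‖ ^ 2) = ∑' i, ENNReal.ofReal (‖c i‖ ^ 2 * M i) := by
    have h3 : ∫⁻ z, ‖u z‖ₑ ^ 2 ∂ν = ∫⁻ z, ‖g z‖ₑ ^ 2 ∂ν := by
      refine lintegral_congr_ae ?_
      filter_upwards [hu] with z hz
      rw [hz]
    rw [← S.lintegral_sq hg hc, ← h3, ENNReal.ofReal_pow (norm_nonneg _), ofReal_norm, Lp.enorm_def,
      eLpNorm_eq_lintegral_rpow_enorm_toReal (by norm_num) (by norm_num),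
      ← ENNReal.rpow_natCast, ← ENNReal.rpow_mul]
    simp
  have h5 := ENNReal.hasSum_toReal (h2 ▸ ENNReal.ofReal_ne_top)
  rw [← ENNReal.tsum_toReal_eq fun i => ENNReal.ofReal_ne_top, ← h2,
    ENNReal.toReal_ofReal (by positivity)] at h5
  refine h5.congr_fun fun i => ?_
  rw [ENNReal.toReal_ofReal]
  have := S.M_pos i
  positivity

theorem unitMonomial_mem (S : CircularSetting D ν m r w M) (i : ι) :
    S.unitMonomial i ∈ holHilbert D ν :=
  Submodule.le_topologicalClosure _ (Submodule.smul_mem _ _ (S.monomial_mem i))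

theorem orthonormal_unitMonomial_mem (S : CircularSetting D ν m r w M) :
    Orthonormal ℂ fun i => (⟨S.unitMonomial i, S.unitMonomial_mem i⟩ : holHilbert D ν) :=
  ⟨fun i => S.orthonormal_unitMonomial.1 i, fun _ _ hij => S.orthonormal_unitMonomial.2 hij⟩

/-- An element of the closed subspace that is orthogonal to all unit monomials lies, by
`holContL2_le`, both in their closed span and in its orthogonal complement. -/
theorem orthogonal_unitMonomial_mem (S : CircularSetting D ν m r w M) :
    (Submodule.span ℂ (Set.range fun i =>
      (⟨S.unitMonomial i, S.unitMonomial_mem i⟩ : holHilbert D ν)))ᗮ = ⊥ := by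
  rw [Submodule.eq_bot_iff]
  rintro ⟨x, hx⟩ hx'
  have h1 : x ∈ (Submodule.span ℂ (Set.range S.unitMonomial)).topologicalClosure :=
    Submodule.topologicalClosure_minimal _ S.holContL2_le
      (Submodule.isClosed_topologicalClosure _) hx
  have h2 : x ∈ (Submodule.span ℂ (Set.range S.unitMonomial)).topologicalClosureᗮ := by
    rw [Submodule.orthogonal_closure, Submodule.mem_orthogonal]
    rw [Submodule.mem_orthogonal] at hx'
    intro y hy
    induction hy using Submodule.span_induction with
    | mem y hy =>
      obtain ⟨i, rfl⟩ := hy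
      exact hx' _ (Submodule.subset_span ⟨i, rfl⟩)
    | zero => exact inner_zero_left _
    | add y z _ _ h3 h4 => rw [inner_add_left, h3, h4, add_zero]
    | smul a y _ h3 => rw [inner_smul_left, h3, mul_zero]
  have h3 := Submodule.inner_right_of_mem_orthogonal h1 h2
  exact Subtype.ext (inner_self_eq_zero.1 h3)

/-- The normalized monomials form a Hilbert basis of the space of holomorphic functions. -/
def hilbertBasis (S : CircularSetting D ν m r w M) : HilbertBasis ι ℂ (holHilbert D ν) :=
  HilbertBasis.mkOfOrthogonalEqBot S.orthonormal_unitMonomial_mem S.orthogonal_unitMonomial_mem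

theorem coe_hilbertBasis (S : CircularSetting D ν m r w M) (i : ι) :
    (S.hilbertBasis i : Lp ℂ 2 ν) = S.unitMonomial i := by
  rw [hilbertBasis, HilbertBasis.coe_mkOfOrthogonalEqBot]

end CircularSetting

/-! ### Coherent families of vectors and the unitary transform. -/

section Realization

variable {ι : Type*} {D : Set ℂ} {ν : Measure ℂ} {m : ι → ℤ} {r w : ℕ → ℝ} {M : ι → ℝ}
  {H : Type*} [NormedAddCommGroup H] [InnerProductSpace ℂ H]

/-- An orthogonal system of vectors dual to the monomials `z ^ m i`: the coefficients of a
holomorphic family of vectors. -/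
structure CoherentSystem (D : Set ℂ) (m : ι → ℤ) (M : ι → ℝ) (f : ι → H) : Prop where
  inner_eq_zero : ∀ i j, i ≠ j → inner ℂ (f i) (f j) = 0
  norm_sq_mul : ∀ i, ‖f i‖ ^ 2 * M i = 1
  dense_span : (Submodule.span ℂ (Set.range f)).topologicalClosure = ⊤
  bound : ∀ z ∈ D, ∃ V, IsOpen V ∧ z ∈ V ∧ ∃ u : ι → ℝ, Summable u ∧
    ∀ i, ∀ x ∈ V, ‖x ^ m i‖ * ‖f i‖ ≤ u i

namespace CoherentSystem

variable {f : ι → H}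

theorem norm_pos (C : CoherentSystem D m M f) (i : ι) : 0 < ‖f i‖ := by
  rcases (norm_nonneg (f i)).eq_or_lt with h | h
  · have := C.norm_sq_mul i
    rw [← h] at this
    simp at this
  · exact h

theorem orthonormal (C : CoherentSystem D m M f) :
    Orthonormal ℂ fun i => ((‖f i‖⁻¹ : ℝ) : ℂ) • f i := by
  refine ⟨fun i => ?_, fun i j hij => ?_⟩
  · rw [norm_smul, Complex.norm_real, norm_inv, norm_norm, inv_mul_cancel₀ (C.norm_pos i).ne']
  · simp only [inner_smul_left, inner_smul_right, C.inner_eq_zero i j hij, mul_zero]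

theorem orthogonal_eq_bot (C : CoherentSystem D m M f) :
    (Submodule.span ℂ (Set.range fun i => ((‖f i‖⁻¹ : ℝ) : ℂ) • f i))ᗮ = ⊥ := by
  have h1 : Submodule.span ℂ (Set.range f) ≤
      Submodule.span ℂ (Set.range fun i => ((‖f i‖⁻¹ : ℝ) : ℂ) • f i) := by
    rw [Submodule.span_le]
    rintro _ ⟨i, rfl⟩
    have h2 : f i = (‖f i‖ : ℂ) • (((‖f i‖⁻¹ : ℝ) : ℂ) • f i) := by
      rw [smul_smul, ← Complex.ofReal_mul, mul_inv_cancel₀ (C.norm_pos i).ne', Complex.ofReal_one,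
        one_smul]
    rw [h2]
    exact Submodule.smul_mem _ _ (Submodule.subset_span ⟨i, rfl⟩)
  rw [eq_bot_iff, ← Submodule.top_orthogonal_eq_bot, ← C.dense_span, Submodule.orthogonal_closure]
  exact Submodule.orthogonal_le h1

variable [CompleteSpace H]

theorem summable (C : CoherentSystem D m M f) {z : ℂ} (hz : z ∈ D) :
    Summable fun i => z ^ m i • f i := by
  obtain ⟨V, -, hzV, u, hu, hb⟩ := C.bound z hz
  exact Summable.of_norm_bounded hu fun i => by simpa only [norm_smul] using hb i z hzV

theorem hasSum_thetaMap (C : CoherentSystem D m M f) (hD : ∀ z ∈ D, starRingEnd ℂ z ∈ D) (x : H)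
    {z : ℂ} (hz : z ∈ D) : HasSum (fun i => inner ℂ (f i) x * z ^ m i)
      (thetaMap (fun z => ∑' i, z ^ m i • f i) x z) := by
  have h1 := (C.summable (hD z hz)).hasSum
  have h2 := ((innerSL ℂ x).hasSum h1).star
  simp only [innerSL_apply_apply] at h2
  rw [thetaMap, ← inner_conj_symm]
  refine h2.congr_fun fun i => ?_
  rw [inner_smul_right, star_mul', ← map_zpow₀]
  simp [mul_comm]

/-- By orthogonality only the diagonal of the double series survives. -/
theorem hasSum_inner (C : CoherentSystem D m M f) {z x : ℂ} (hz : z ∈ D) (hx : x ∈ D) :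
    HasSum (fun i => ((‖f i‖ ^ 2 : ℝ) : ℂ) * (z * starRingEnd ℂ x) ^ m i)
      (inner ℂ (∑' i, x ^ m i • f i) (∑' i, z ^ m i • f i)) := by
  have h1 := (innerSL ℂ (∑' i, x ^ m i • f i)).hasSum (C.summable hz).hasSum
  refine h1.congr_fun fun i => ?_
  have h2 := ((innerSL ℂ (f i)).hasSum (C.summable hx).hasSum).map (starRingEnd ℂ)
    Complex.continuous_conj
  have h3 := h2.unique (hasSum_single i fun j hj => by
    rw [Function.comp_apply, innerSL_apply_apply, inner_smul_right, C.inner_eq_zero i j hj.symm, mul_zero, map_zero])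
  simp only [Function.comp_apply, innerSL_apply_apply] at h3
  rw [innerSL_apply_apply, inner_smul_right, ← inner_conj_symm]
  rw [h3, inner_smul_right, inner_self_eq_norm_sq_to_K, map_mul, mul_zpow, ← map_zpow₀]
  simp only [map_pow, Complex.coe_algebraMap, Complex.conj_ofReal]
  push_cast
  ring

theorem differentiableOn (C : CoherentSystem D m M f) 
    (hm : ∀ i, DifferentiableOn ℂ (fun z : ℂ => z ^ m i) D) (hD : IsOpen D) :
    DifferentiableOn ℂ (fun z => ∑' i, z ^ m i • f i) D := by
  intro z hz
  obtain ⟨V, hV, hzV, u, hu, hb⟩ := C.bound z hz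
  have := Complex.differentiableOn_tsum_of_summable_norm (U := V ∩ D)
    (F := fun i z => z ^ m i • f i) hu
    (fun i => ((hm i).mono Set.inter_subset_right).smul_const (f i)) (hV.inter hD)
    (fun i x hx => by simpa only [norm_smul] using hb i x hx.1)
  exact (this.differentiableAt ((hV.inter hD).mem_nhds ⟨hzV, hz⟩)).differentiableWithinAt

/-- The Weierstrass test, with majorant `u i * ‖x‖` supplied by `bound` and the Cauchy–Schwarz
inequality. -/
theorem tendstoLocallyUniformlyOn (C : CoherentSystem D m M f)
    (hD : ∀ z ∈ D, starRingEnd ℂ z ∈ D) (x : H) :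
    TendstoLocallyUniformlyOn (fun (s : Finset ι) z => ∑ i ∈ s, inner ℂ (f i) x * z ^ m i)
      (thetaMap (fun z => ∑' i, z ^ m i • f i) x) atTop D := by
  intro ε hε z hz
  obtain ⟨V, hV, hzV, u, hu, hb⟩ := C.bound z hz
  refine ⟨V ∩ D, inter_mem (mem_nhdsWithin_of_mem_nhds (hV.mem_nhds hzV)) self_mem_nhdsWithin, ?_⟩
  have h1 := tendstoUniformlyOn_tsum (f := fun i (y : ℂ) => inner ℂ (f i) x * y ^ m i)
    (s := V ∩ D) (hu.mul_right ‖x‖) (fun i y hy => by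
      rw [norm_mul]
      calc ‖inner ℂ (f i) x‖ * ‖y ^ m i‖ ≤ ‖f i‖ * ‖x‖ * ‖y ^ m i‖ := by
            gcongr
            exact norm_inner_le_norm _ _
        _ = ‖y ^ m i‖ * ‖f i‖ * ‖x‖ := by ring
        _ ≤ u i * ‖x‖ := by
            gcongr
            exact hb i y hy.1)
  filter_upwards [h1 ε hε] with s hs y hy
  rw [← (C.hasSum_thetaMap hD x hy.2).tsum_eq]
  exact hs y hy

/-- The unitary map matches two Hilbert bases: f_i/‖f_i‖ goes to z^(m i)/√(M i). Since ‖f_i‖ √(M i)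
= 1, the image of x is the L² sum of the series that converges pointwise to θ(x). -/
theorem isHolomorphicRealization [Countable ι] (C : CoherentSystem D m M f)
    (S : CircularSetting D ν m r w M) :
    IsHolomorphicRealization (fun z => ∑' i, z ^ m i • f i) D ν := by
  have hloc := C.tendstoLocallyUniformlyOn S.conj_mem
  have hcont : ∀ (x : H) (s : Finset ι), IsHolCont D fun z => ∑ i ∈ s, inner ℂ (f i) x * z ^ m i :=
    fun x s => IsHolCont.sum s fun i _ =>
      ⟨(S.isHolCont_zpow i).1.const_mul _, continuousOn_const.mul (S.isHolCont_zpow i).2⟩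
  refine ⟨fun x => (hloc x).differentiableOn (Eventually.of_forall fun s => (hcont x s).1) S.isOpen,
    ?_⟩
  let b := HilbertBasis.mkOfOrthogonalEqBot C.orthonormal C.orthogonal_eq_bot
  have hb : ∀ i, b i = ((‖f i‖⁻¹ : ℝ) : ℂ) • f i := fun i => by
    rw [HilbertBasis.coe_mkOfOrthogonalEqBot]
  refine ⟨b.repr.trans S.hilbertBasis.repr.symm, fun x => ?_⟩
  set u : Lp ℂ 2 ν :=
    (((b.repr.trans S.hilbertBasis.repr.symm) x : holHilbert D ν) : Lp ℂ 2 ν) with hu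
  have hsum : HasSum (fun i => (inner ℂ (f i) x : ℂ) • S.monomial i) u := by
    have h1 := (holHilbert D ν).subtypeL.hasSum (S.hilbertBasis.hasSum_repr_symm (b.repr x))
    refine h1.congr_fun fun i => ?_
    rw [map_smul, Submodule.subtypeL_apply, S.coe_hilbertBasis, CircularSetting.unitMonomial,
      smul_smul, HilbertBasis.repr_apply_apply, hb, inner_smul_left, Complex.conj_ofReal]
    congr 1
    have h2 : ‖f i‖ * √(M i) = 1 := by
      rw [← Real.sqrt_sq (norm_nonneg (f i)), ← Real.sqrt_mul (by positivity), C.norm_sq_mul,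
        Real.sqrt_one]
    rw [mul_right_comm, ← Complex.ofReal_inv, ← Complex.ofReal_mul, ← mul_inv, h2]
    simp
  -- Countability of ι makes `atTop` on finite sets countably generated; a sequence of partial sums
  -- is needed for `IsRepresentedBy` and for extracting an almost everywhere convergent subsequence.
  obtain ⟨s, hs⟩ := exists_seq_tendsto (atTop : Filter (Finset ι))
  have hmem : ∀ n, MemLp (fun z => ∑ i ∈ s n, inner ℂ (f i) x * z ^ m i) 2 ν := fun n =>
    memLp_finsetSum _ fun i _ => (S.memLp_zpow i).const_mul _
  have htoLp : ∀ n, (hmem n).toLp = ∑ i ∈ s n, (inner ℂ (f i) x : ℂ) • S.monomial i := by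
    intro n
    exact Lp.ext ((hmem n).coeFn_toLp.trans (S.coeFn_sum_monomial _ _).symm)
  have hlim : Tendsto (fun n => eLpNorm
      ((fun z => ∑ i ∈ s n, inner ℂ (f i) x * z ^ m i) - (u : ℂ → ℂ)) 2 ν) atTop (𝓝 0) := by
    rw [← Lp.tendsto_Lp_iff_tendsto_eLpNorm'' _ hmem _ (Lp.memLp u), Lp.toLp_coeFn]
    simp_rw [htoLp]
    exact hsum.comp hs
  refine ⟨?_, fun n z => ∑ i ∈ s n, inner ℂ (f i) x * z ^ m i, fun n => hcont x (s n), ?_, hlim⟩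
  -- A subsequence converges almost everywhere to u, while in D the partial sums converge pointwise
  -- to θ(x); so the two limits agree almost everywhere in D.
  · obtain ⟨ns, hns, hae⟩ := (tendstoInMeasure_of_tendsto_eLpNorm (by norm_num)
      (fun n => (hmem n).1) (Lp.aestronglyMeasurable u) hlim).exists_seq_tendsto_ae
    rw [EventuallyEq, ae_restrict_iff' S.isOpen.measurableSet]
    filter_upwards [hae] with z hz hzD
    exact tendsto_nhds_unique hz
      (((C.hasSum_thetaMap S.conj_mem x hzD).comp hs).comp hns.tendsto_atTop)
  · intro ε hε z hz
    obtain ⟨t, ht, h⟩ := hloc x ε hε z hz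
    exact ⟨t, ht, hs.eventually h⟩

end CoherentSystem

end Realization

/-! ### Weight vectors and the closed operator of the holomorphic coordinate. -/

namespace UqSU11Rep

variable {q : ℝ} {H : Type*} [NormedAddCommGroup H] [InnerProductSpace ℂ H]
  {T : UqSU11Rep q H} {ι : Type*}

/-- A family of nonzero weight vectors with distinct weights `κ i`, spanning an invariant
subspace. -/
structure IsWeightFamily (T : UqSU11Rep q H) (f : ι → T.dom) (κ : ι → ℝ) : Prop where
  injective : Function.Injective κ
  weight_ne_zero : ∀ i, κ i ≠ 0
  ne_zero : ∀ i, f i ≠ 0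
  K_apply : ∀ i, T.K (f i) = (κ i : ℂ) • f i
  E_mem : ∀ i, T.E (f i) ∈ Submodule.span ℂ (Set.range f)
  F_mem : ∀ i, T.F (f i) ∈ Submodule.span ℂ (Set.range f)

theorem Kinv_apply_of_K_apply {κ : ℝ} (hκ : κ ≠ 0) {u : T.dom} (hu : T.K u = (κ : ℂ) • u) :
    T.Kinv u = (κ : ℂ)⁻¹ • u := by
  have h1 : T.Kinv (T.K u) = u := congrArg (fun A : Module.End ℂ T.dom => A u) T.Kinv_mul_K
  rw [hu, map_smul] at h1
  have h2 : (κ : ℂ) ≠ 0 := by exact_mod_cast hκ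
  rw [← h1, smul_smul, inv_mul_cancel₀ h2, one_smul, h1]

theorem K_E_apply {κ : ℂ} {u : T.dom} (hu : T.K u = κ • u) :
    T.K (T.E u) = (((q : ℂ) ^ 2)⁻¹ * κ) • T.E u := by
  have h1 := congrArg (fun A : Module.End ℂ T.dom => A u) T.K_mul_E
  simp only [Module.End.mul_apply, LinearMap.smul_apply] at h1
  rw [h1, hu, map_smul, smul_smul]

theorem K_F_apply {κ : ℂ} {u : T.dom} (hu : T.K u = κ • u) :
    T.K (T.F u) = ((q : ℂ) ^ 2 * κ) • T.F u := by
  have h1 := congrArg (fun A : Module.End ℂ T.dom => A u) T.K_mul_F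
  simp only [Module.End.mul_apply, LinearMap.smul_apply] at h1
  rw [h1, hu, map_smul, smul_smul]

theorem E_F_apply {κ : ℝ} (hκ : κ ≠ 0) {u : T.dom} (hu : T.K u = (κ : ℂ) • u) :
    T.E (T.F u) = T.F (T.E u) + (((q : ℂ)⁻¹ - q)⁻¹ * ((κ : ℂ) - (κ : ℂ)⁻¹)) • u := by
  have h1 := congrArg (fun A : Module.End ℂ T.dom => A u) T.E_comm_F
  simp only [Module.End.mul_apply, LinearMap.smul_apply, LinearMap.sub_apply, hu,
    Kinv_apply_of_K_apply hκ hu, ← sub_smul, smul_smul] at h1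
  rw [← h1]
  abel

/-- The relation between the norms of neighbouring weight vectors. -/
theorem mul_norm_sq_eq {κ γ φ : ℝ} (hκ : κ ≠ 0) {u v : T.dom} (hK : T.K v = (κ : ℂ) • v)
    (hE : T.E v = (γ : ℂ) • u) (hF : T.F u = (φ : ℂ) • v) :
    γ * ‖u‖ ^ 2 = -q * φ * κ⁻¹ * ‖v‖ ^ 2 := by
  have h1 := T.E_star v u
  simp only [LinearMap.smul_apply, Module.End.mul_apply, hE, hF, map_smul,
    Kinv_apply_of_K_apply hκ hK, Submodule.coe_smul, inner_smul_left, inner_smul_right,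
    inner_self_eq_norm_sq_to_K, Complex.conj_ofReal] at h1
  simp only [Complex.coe_algebraMap, ← Submodule.coe_norm] at h1
  have h2 : ((γ * ‖u‖ ^ 2 : ℝ) : ℂ) = ((-q * φ * κ⁻¹ * ‖v‖ ^ 2 : ℝ) : ℂ) := by
    push_cast
    rw [h1]
    ring
  exact_mod_cast h2

namespace IsWeightFamily

variable {f : ι → T.dom} {κ : ι → ℝ}

theorem span_eq_top [Nonempty ι] (W : IsWeightFamily T f κ) (hT : T.IsIrreducible) :
    Submodule.span ℂ (Set.range f) = ⊤ := by
  have hmem : ∀ i, f i ∈ Submodule.span ℂ (Set.range f) := fun i =>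
    Submodule.subset_span ⟨i, rfl⟩
  have key : ∀ A : Module.End ℂ T.dom, (∀ i, A (f i) ∈ Submodule.span ℂ (Set.range f)) →
      ∀ u ∈ Submodule.span ℂ (Set.range f), A u ∈ Submodule.span ℂ (Set.range f) := by
    intro A hA
    suffices Submodule.span ℂ (Set.range f) ≤ (Submodule.span ℂ (Set.range f)).comap A from this
    rw [Submodule.span_le]
    rintro _ ⟨i, rfl⟩
    exact hA i
  refine (hT.2 _ fun u hu => ⟨key _ W.E_mem u hu, key _ W.F_mem u hu, key _ (fun i => ?_) u hu,
    key _ (fun i => ?_) u hu⟩).resolve_left fun hbot => ?_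
  · rw [W.K_apply]
    exact Submodule.smul_mem _ _ (hmem i)
  · rw [Kinv_apply_of_K_apply (W.weight_ne_zero i) (W.K_apply i)]
    exact Submodule.smul_mem _ _ (hmem i)
  · obtain ⟨i⟩ := ‹Nonempty ι›
    have h := hmem i
    rw [hbot, Submodule.mem_bot] at h
    exact W.ne_zero i h

/-- Eigenvectors of the symmetric operator `K` for distinct real eigenvalues. -/
theorem inner_eq_zero (W : IsWeightFamily T f κ) {i j : ι} (hij : i ≠ j) :
    inner ℂ (f i : H) (f j : H) = 0 := by
  have h1 := T.K_star (f i) (f j)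
  simp only [W.K_apply, Submodule.coe_smul, inner_smul_left, inner_smul_right,
    Complex.conj_ofReal] at h1
  have h2 : ((κ i : ℂ) - κ j) * inner ℂ (f i : H) (f j : H) = 0 := by rw [sub_mul, h1, sub_self]
  refine (mul_eq_zero.1 h2).resolve_left ?_
  refine sub_ne_zero.2 ?_
  exact_mod_cast fun h => hij (W.injective h)

theorem topologicalClosure_span_eq_top [Nonempty ι] (W : IsWeightFamily T f κ)
    (hT : T.IsIrreducible) :
    (Submodule.span ℂ (Set.range fun i => (f i : H))).topologicalClosure = ⊤ := by
  have h1 : Submodule.span ℂ (Set.range fun i => (f i : H)) = T.dom := by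
    have h2 := congrArg (Submodule.map T.dom.subtype) (W.span_eq_top hT)
    rw [Submodule.map_span, Submodule.map_top, Submodule.range_subtype, ← Set.range_comp] at h2
    exact h2
  rw [h1, ← Submodule.dense_iff_topologicalClosure_eq_top]
  exact T.dense_dom

/-- The operator is diagonal on the spanning family, with nonzero eigenvalues. Invertibility is what
makes `zeta` meaningful, as `Ring.inverse` is zero on non-units. -/
theorem isUnit_sub (W : IsWeightFamily T f κ) [Nonempty ι] (hT : T.IsIrreducible) {s c : ℝ}
    (h : ∀ i, q * (s * κ i) ≠ c) : IsUnit ((q : ℂ) • T.x s - (c : ℂ) • 1) := by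
  have hB : ∀ i, ((q : ℂ) • T.x s - (c : ℂ) • 1 : Module.End ℂ T.dom) (f i) =
      ((q * (s * κ i) - c : ℝ) : ℂ) • f i := by
    intro i
    simp only [UqSU11Rep.x, LinearMap.sub_apply, LinearMap.smul_apply, W.K_apply,
      Module.End.one_apply, smul_smul, ← sub_smul]
    push_cast
    ring_nf
  have hne : ∀ i, ((q * (s * κ i) - c : ℝ) : ℂ) ≠ 0 := fun i => by
    exact_mod_cast sub_ne_zero.2 (h i)
  rw [Module.End.isUnit_iff]
  constructor
  · rw [← LinearMap.ker_eq_bot, LinearMap.ker_eq_bot']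
    intro u hu
    -- Injectivity by symmetry of `K`: a kernel element is orthogonal to every weight vector, hence
    -- to the whole module, hence to itself.
    have h1 : ∀ i, inner ℂ (f i : H) (u : H) = 0 := by
      intro i
      have h2 := T.K_star (f i) u
      have h3 : inner ℂ (f i : H)
          ((((q : ℂ) • T.x s - (c : ℂ) • 1 : Module.End ℂ T.dom) u : T.dom) : H) = 0 := by
        rw [hu]
        simp
      simp only [UqSU11Rep.x, LinearMap.sub_apply, LinearMap.smul_apply, Module.End.one_apply,
        Submodule.coe_sub, Submodule.coe_smul, inner_sub_right, inner_smul_right, ← h2,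
        W.K_apply, inner_smul_left, Complex.conj_ofReal] at h3
      refine (mul_eq_zero.1 (?_ : ((q * (s * κ i) - c : ℝ) : ℂ) * inner ℂ (f i : H) (u : H) =
        0)).resolve_left (hne i)
      rw [← h3]
      push_cast
      ring
    have h4 : ∀ v ∈ Submodule.span ℂ (Set.range f), inner ℂ (v : H) (u : H) = 0 := by
      intro v hv
      induction hv using Submodule.span_induction with
      | mem v hv =>
        obtain ⟨i, rfl⟩ := hv
        exact h1 i
      | zero => simp
      | add v w _ _ h5 h6 => rw [Submodule.coe_add, inner_add_left, h5, h6, add_zero]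
      | smul a v _ h5 => rw [Submodule.coe_smul, inner_smul_left, h5, mul_zero]
    rw [W.span_eq_top hT] at h4
    exact Subtype.ext (inner_self_eq_zero.1 (h4 u trivial))
  · rw [← LinearMap.range_eq_top, eq_top_iff, ← W.span_eq_top hT, Submodule.span_le]
    rintro _ ⟨i, rfl⟩
    refine ⟨(((q * (s * κ i) - c : ℝ) : ℂ))⁻¹ • f i, ?_⟩
    rw [map_smul, hB, smul_smul, inv_mul_cancel₀ (hne i), one_smul]

theorem zeta_apply (W : IsWeightFamily T f κ) [Nonempty ι] (hT : T.IsIrreducible) {s c : ℝ}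
    (h : ∀ i, q * (s * κ i) ≠ c) {u v : T.dom} {κ' γ : ℝ} (hu : T.E u = (γ : ℂ) • v)
    (hv : T.K v = (κ' : ℂ) • v) (hκ' : q * (s * κ') ≠ c) :
    T.zeta s c u = ((-(1 - q ^ 2) * s * κ' * γ / (q * (s * κ') - c) : ℝ) : ℂ) • v := by
  have hunit := W.isUnit_sub hT h
  set B : Module.End ℂ T.dom := (q : ℂ) • T.x s - (c : ℂ) • 1 with hB
  have hne : ((q * (s * κ') - c : ℝ) : ℂ) ≠ 0 := by exact_mod_cast sub_ne_zero.2 hκ'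
  have h1 : B v = ((q * (s * κ') - c : ℝ) : ℂ) • v := by
    simp only [hB, UqSU11Rep.x, LinearMap.sub_apply, LinearMap.smul_apply, hv,
      Module.End.one_apply, smul_smul, ← sub_smul]
    push_cast
    ring_nf
  have h2 : T.y s u =
      B (((-(1 - q ^ 2) * s * κ' * γ / (q * (s * κ') - c) : ℝ) : ℂ) • v) := by
    rw [map_smul, h1, smul_smul]
    simp only [UqSU11Rep.y, UqSU11Rep.x, LinearMap.smul_apply, Module.End.mul_apply, hu, map_smul,
      hv, smul_smul]
    congr 1
    rw [← Complex.ofReal_mul (_ / _), div_mul_cancel₀ _ (sub_ne_zero.2 hκ')]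
    push_cast
    ring
  have h3 : Ring.inverse B * B = 1 := Ring.inverse_mul_cancel B hunit
  rw [UqSU11Rep.zeta, Module.End.mul_apply, h2, ← hB, ← Module.End.mul_apply, h3,
    Module.End.one_apply]

/-- Closability of an operator on the module for which all weight vectors lie in the domain of the
adjoint. -/
theorem isClosable (W : IsWeightFamily T f κ) [Nonempty ι] (hT : T.IsIrreducible)
    [CompleteSpace H] (A : Module.End ℂ T.dom)
    (hA : ∀ i, ∃ η : H, ∀ j, inner ℂ (f i : H) (A (f j) : H) = inner ℂ η (f j : H)) :
    (⟨T.dom, T.dom.subtype ∘ₗ A⟩ : H →ₗ.[ℂ] H).IsClosable := by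
  set P : H →ₗ.[ℂ] H := ⟨T.dom, T.dom.subtype ∘ₗ A⟩ with hP
  -- Closability means that (0, y) in the closed graph forces y = 0. The relation (f_i, A u) = (η,
  -- u) passes to the closure of the graph, so y is orthogonal to every `f i`.
  refine ⟨P.graph.topologicalClosure.toLinearPMap,
    (Submodule.toLinearPMap_graph_eq _ fun x hx hx0 => ?_).symm⟩
  have h1 : ∀ i, inner ℂ (f i : H) x.2 = 0 := by
    intro i
    obtain ⟨η, hη⟩ := hA i
    have h2 : ∀ u ∈ Submodule.span ℂ (Set.range f),
        inner ℂ (f i : H) (A u : H) = inner ℂ η (u : H) := by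
      intro u hu
      induction hu using Submodule.span_induction with
      | mem u hu =>
        obtain ⟨j, rfl⟩ := hu
        exact hη j
      | zero => simp
      | add u v _ _ h5 h6 =>
        rw [map_add, Submodule.coe_add, Submodule.coe_add, inner_add_right, inner_add_right, h5, h6]
      | smul a u _ h5 =>
        rw [map_smul, Submodule.coe_smul, Submodule.coe_smul, inner_smul_right, inner_smul_right,
          h5]
    rw [W.span_eq_top hT] at h2
    have h3 : IsClosed {y : H × H | inner ℂ (f i : H) y.2 = inner ℂ η y.1} :=
      isClosed_eq (by fun_prop) (by fun_prop)
    have h4 : (P.graph : Set (H × H)) ⊆ {y : H × H | inner ℂ (f i : H) y.2 = inner ℂ η y.1} := by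
      rintro ⟨a, b⟩ hab
      obtain ⟨u, hu1, hu2⟩ := (LinearPMap.mem_graph_iff P).1 hab
      simp only at hu1 hu2
      rw [Set.mem_ofPred_eq, ← hu1, ← hu2]
      exact h2 u trivial
    have h5 := closure_minimal h4 h3 hx
    rw [Set.mem_ofPred_eq, hx0, inner_zero_right] at h5
    exact h5
  have h6 : x.2 ∈ (Submodule.span ℂ (Set.range fun i => (f i : H))).topologicalClosureᗮ := by
    rw [Submodule.orthogonal_closure, Submodule.mem_orthogonal]
    intro y hy
    induction hy using Submodule.span_induction with
    | mem y hy =>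
      obtain ⟨i, rfl⟩ := hy
      exact h1 i
    | zero => exact inner_zero_left _
    | add y z _ _ h3 h4 => rw [inner_add_left, h3, h4, add_zero]
    | smul a y _ h3 => rw [inner_smul_left, h3, mul_zero]
  rw [W.topologicalClosure_span_eq_top hT, Submodule.top_orthogonal_eq_bot] at h6
  exact h6

/-- Partial sums give points of the graph converging to (x, y). Closability is essential:
`LinearPMap.closure` leaves a non-closable operator unchanged. -/
theorem mem_graph_zetaClosed (W : IsWeightFamily T f κ) [Nonempty ι] (hT : T.IsIrreducible)
    [CompleteSpace H] {s c : ℝ}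
    (hA : ∀ i, ∃ η : H, ∀ j, inner ℂ (f i : H) ((c : ℂ) • T.zeta s c (f j) : T.dom) =
      inner ℂ η (f j : H)) {a : ι → ℂ} {x y : H} (hx : HasSum (fun i => a i • (f i : H)) x)
    (hy : HasSum (fun i => a i • (((c : ℂ) • T.zeta s c (f i) : T.dom) : H)) y) :
    (x, y) ∈ (T.zetaClosed s c).graph := by
  have hcl := W.isClosable hT ((c : ℂ) • T.zeta s c) hA
  rw [UqSU11Rep.zetaClosed, ← hcl.graph_closure_eq_closure_graph]
  refine mem_closure_of_tendsto (hx.prodMk_nhds hy) (Eventually.of_forall fun t => ?_)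
  refine (LinearPMap.mem_graph_iff _).2 ⟨∑ i ∈ t, a i • f i, ?_, ?_⟩
  · simp
  · change (((c : ℂ) • T.zeta s c) (∑ i ∈ t, a i • f i) : H) = _
    simp

end IsWeightFamily

end UqSU11Rep

/-! ### The q-binomial coefficients and the moments of the disc measure. -/

/-- The coefficients `(B; t)_k / (t; t)_k` of the `q`-binomial series. -/
def qBinomCoeff (B t : ℝ) (k : ℕ) : ℝ :=
  ∏ j ∈ Finset.range k, (1 - B * t ^ j) / (1 - t ^ (j + 1))

section QBinomCoeff

variable {B t : ℝ}

theorem one_sub_pow_pos (ht0 : 0 < t) (ht1 : t < 1) (k : ℕ) : 0 < 1 - t ^ (k + 1) :=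
  sub_pos.2 (pow_lt_one₀ ht0.le ht1 (Nat.succ_ne_zero k))

theorem one_sub_mul_pow_pos (ht0 : 0 < t) (ht1 : t < 1) (hB : B < 1) (k : ℕ) :
    0 < 1 - B * t ^ k := by
  rcases le_or_gt B 0 with h | h
  · have : B * t ^ k ≤ 0 := mul_nonpos_of_nonpos_of_nonneg h (by positivity)
    linarith
  · have : B * t ^ k ≤ B := mul_le_of_le_one_right h.le (pow_le_one₀ ht0.le ht1.le)
    linarith

theorem qBinomCoeff_succ (ht0 : 0 < t) (ht1 : t < 1) (k : ℕ) :
    qBinomCoeff B t (k + 1) * (1 - t ^ (k + 1)) = qBinomCoeff B t k * (1 - B * t ^ k) := by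
  have := (one_sub_pow_pos ht0 ht1 k).ne'
  rw [qBinomCoeff, Finset.prod_range_succ, ← qBinomCoeff]
  field_simp

theorem qBinomCoeff_pos (ht0 : 0 < t) (ht1 : t < 1) (hB : B < 1) (k : ℕ) :
    0 < qBinomCoeff B t k :=
  Finset.prod_pos fun j _ => div_pos (one_sub_mul_pow_pos ht0 ht1 hB j) (one_sub_pow_pos ht0 ht1 j)

theorem summable_qBinomCoeff_mul_pow (ht0 : 0 < t) (ht1 : t < 1) (hB : B < 1) {r : ℝ}
    (hr0 : 0 ≤ r) (hr1 : r < 1) : Summable fun k => qBinomCoeff B t k * r ^ k := by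
  rcases hr0.eq_or_lt with h | h
  · refine summable_of_ne_finset_zero (s := {0}) fun k hk => ?_
    rw [← h, zero_pow (by simpa using hk), mul_zero]
  · refine summable_of_ratio_test_tendsto_lt_one hr1 (Eventually.of_forall fun k =>
      (mul_pos (qBinomCoeff_pos ht0 ht1 hB k) (pow_pos h k)).ne') ?_
    have h1 : ∀ k, ‖qBinomCoeff B t (k + 1) * r ^ (k + 1)‖ / ‖qBinomCoeff B t k * r ^ k‖ =
        (1 - B * t ^ k) / (1 - t ^ (k + 1)) * r := by
      intro k
      have h2 := qBinomCoeff_pos ht0 ht1 hB k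
      have h3 := qBinomCoeff_pos ht0 ht1 hB (k + 1)
      have h4 := one_sub_pow_pos ht0 ht1 k
      have h5 := qBinomCoeff_succ (B := B) ht0 ht1 k
      rw [Real.norm_of_nonneg (by positivity), Real.norm_of_nonneg (by positivity), pow_succ]
      rw [div_eq_iff (by positivity), div_mul_eq_mul_div, div_mul_eq_mul_div, eq_div_iff h4.ne']
      linear_combination r ^ k * r * h5
    simp_rw [h1]
    have h6 := tendsto_pow_atTop_nhds_zero_of_lt_one ht0.le ht1
    have h7 := ((tendsto_const_nhds (x := (1 : ℝ))).sub (h6.const_mul B)).div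
      ((tendsto_const_nhds (x := (1 : ℝ))).sub (h6.comp (tendsto_add_atTop_nat 1))) (by simp)
    simpa using h7.mul_const r

/-- Moments of the measures `ν⁺_l`. -/
theorem hasSum_qBinomCoeff_moment {b : ℝ} (ht0 : 0 < t) (ht1 : t < 1) (hb1 : b < 1)
    (n : ℕ) : HasSum (fun k : ℕ => (1 - b) * (t ^ k * (qPochInfReal (t ^ (k + 1)) t /
      qPochInfReal (b * t ^ k) t)) * (t ^ k) ^ n) (qBinomCoeff (b * t) t n)⁻¹ := by
  have htn : ‖t‖ < 1 := by rwa [Real.norm_of_nonneg ht0.le]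
  have hne : ∀ a : ℝ, a < 1 → qPochInfReal a t ≠ 0 := fun a ha =>
    tprod_one_sub_mul_pow_ne_zero htn fun k => (one_sub_mul_pow_pos ht0 ht1 ha k).ne'
  have hsplit : ∀ (a : ℝ) (k : ℕ), qPochInfReal a t =
      (∏ j ∈ Finset.range k, (1 - a * t ^ j)) * qPochInfReal (a * t ^ k) t :=
    fun a k => tprod_one_sub_mul_pow_eq htn a k
  have ht' : ∀ k : ℕ, t * t ^ k = t ^ (k + 1) := fun k => by ring
  have hpow1 : ∀ k : ℕ, t ^ (k + 1) < 1 := fun k => pow_lt_one₀ ht0.le ht1 (Nat.succ_ne_zero k)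
  -- Splitting off k factors from (t; t)_∞ and (b; t)_∞ turns the weights into q-binomial
  -- coefficients, so the n-th moment is a q-binomial series at t^(n+1).
  have hcoef : ∀ k : ℕ, qPochInfReal (t ^ (k + 1)) t / qPochInfReal (b * t ^ k) t =
      qPochInfReal t t / qPochInfReal b t * qBinomCoeff b t k := by
    intro k
    have h1 := hsplit t k
    have h2 := hsplit b k
    rw [ht'] at h1
    have h3 : ∏ j ∈ Finset.range k, (1 - b * t ^ j) ≠ 0 :=
      (Finset.prod_pos fun j _ => one_sub_mul_pow_pos ht0 ht1 hb1 j).ne'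
    have h4 : ∏ j ∈ Finset.range k, (1 - t * t ^ j) ≠ 0 :=
      (Finset.prod_pos fun j _ => one_sub_mul_pow_pos ht0 ht1 ht1 j).ne'
    have h5 : qPochInfReal (b * t ^ k) t ≠ 0 := by
      intro h
      rw [h, mul_zero] at h2
      exact hne b hb1 h2
    rw [h1, h2, qBinomCoeff, Finset.prod_div_distrib]
    simp only [← ht']
    field_simp
  have hs := summable_qBinomCoeff_mul_pow ht0 ht1 hb1 (r := t ^ (n + 1)) (by positivity) (hpow1 n)
  have hq := tsum_mul_tprod_eq_of_recurrence (𝕜 := ℝ) (t := t) (B := b) (z := t ^ (n + 1)) htn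
    (c := qBinomCoeff b t) (by simp [qBinomCoeff]) (qBinomCoeff_succ ht0 ht1) hs.norm
  change _ * qPochInfReal (t ^ (n + 1)) t = qPochInfReal (b * t ^ (n + 1)) t at hq
  have h1 := hs.hasSum.mul_left ((1 - b) * (qPochInfReal t t / qPochInfReal b t))
  -- The series equals (b t^(n+1); t)_∞ / (t^(n+1); t)_∞, so only (t; t)_n / (b; t)_{n+1} is left;
  -- the prefactor 1 - b cancels the first factor of (b; t)_{n+1} and normalizes the zeroth moment
  -- to 1.
  have h2 : (1 - b) * (qPochInfReal t t / qPochInfReal b t) *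
      ∑' k, qBinomCoeff b t k * (t ^ (n + 1)) ^ k = (qBinomCoeff (b * t) t n)⁻¹ := by
    rw [eq_div_of_mul_eq (hne _ (hpow1 n)) hq, hsplit b (n + 1), hsplit t n, ht',
      Finset.prod_range_succ', qBinomCoeff, Finset.prod_div_distrib, inv_div]
    have h3 : ∏ j ∈ Finset.range n, (1 - b * t ^ (j + 1)) ≠ 0 :=
      (Finset.prod_pos fun j _ => one_sub_mul_pow_pos ht0 ht1 hb1 (j + 1)).ne'
    have h4 : ∏ j ∈ Finset.range n, (1 - b * t ^ (j + 1)) =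
        ∏ j ∈ Finset.range n, (1 - b * t * t ^ j) :=
      Finset.prod_congr rfl fun j _ => by ring
    have h5 : ∏ j ∈ Finset.range n, (1 - t * t ^ j) =
        ∏ j ∈ Finset.range n, (1 - t ^ (j + 1)) :=
      Finset.prod_congr rfl fun j _ => by ring
    have h6 : 1 - b * t ^ 0 ≠ 0 := by simpa using (sub_pos.2 hb1).ne'
    have h7 := hne _ (hpow1 n)
    have h8 : qPochInfReal (b * t ^ (n + 1)) t ≠ 0 := hne _ (by
      have := one_sub_mul_pow_pos ht0 ht1 hb1 (n + 1)
      linarith)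
    rw [← h4, h5]
    rw [pow_zero, mul_one] at h6 ⊢
    field_simp
  rw [h2] at h1
  refine h1.congr_fun fun k => ?_
  rw [hcoef]
  have : (t ^ (n + 1)) ^ k = t ^ k * (t ^ k) ^ n := by ring
  rw [this]
  ring

end QBinomCoeff

/-! ### The highest weight module. -/

namespace UqSU11Rep

variable {q : ℝ} {H : Type*} [NormedAddCommGroup H] [InnerProductSpace ℂ H]
  {T : UqSU11Rep q H}

/-- The family of weight vectors generated by a highest weight vector. -/
def highestWeightFamily (T : UqSU11Rep q H) (v : T.dom) : ℕ → T.dom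
  | 0 => ((‖v‖⁻¹ : ℝ) : ℂ) • v
  | k + 1 => ((-(1 - q ^ 2) / (q * (1 - (q ^ 2) ^ (k + 1))) : ℝ) : ℂ) •
      T.F (highestWeightFamily T v k)

section HighestWeight

variable {Λ : ℝ} {v : T.dom}

theorem highestWeightFamily_succ (k : ℕ) : T.highestWeightFamily v (k + 1) =
    ((-(1 - q ^ 2) / (q * (1 - (q ^ 2) ^ (k + 1))) : ℝ) : ℂ) • T.F (T.highestWeightFamily v k) :=
  rfl

theorem F_highestWeightFamily (hq0 : 0 < q) (hq1 : q < 1) (k : ℕ) :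
    T.F (T.highestWeightFamily v k) = ((-(q * (1 - (q ^ 2) ^ (k + 1))) / (1 - q ^ 2) : ℝ) : ℂ) •
      T.highestWeightFamily v (k + 1) := by
  have ht1 : q ^ 2 < 1 := pow_lt_one₀ hq0.le hq1 two_ne_zero
  have h1 := (one_sub_pow_pos (by positivity) ht1 k).ne'
  have h2 := (sub_pos.2 ht1).ne'
  rw [highestWeightFamily, smul_smul, ← Complex.ofReal_mul]
  have h3 : -(q * (1 - (q ^ 2) ^ (k + 1))) / (1 - q ^ 2) *
      (-(1 - q ^ 2) / (q * (1 - (q ^ 2) ^ (k + 1)))) = 1 := by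
    field_simp
  rw [h3, Complex.ofReal_one, one_smul]

theorem K_highestWeightFamily (hK : T.K v = (Λ : ℂ) • v) (k : ℕ) :
    T.K (T.highestWeightFamily v k) = ((Λ * (q ^ 2) ^ k : ℝ) : ℂ) • T.highestWeightFamily v k := by
  induction k with
  | zero =>
    rw [highestWeightFamily, map_smul, hK, smul_comm]
    simp
  | succ k ih =>
    rw [highestWeightFamily, map_smul, K_F_apply ih, smul_comm]
    congr 1
    push_cast
    ring

theorem E_highestWeightFamily_zero (hE : T.E v = 0) : T.E (T.highestWeightFamily v 0) = 0 := by
  rw [highestWeightFamily, map_smul, hE, smul_zero]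

/-- Induction moving `E` past `F` with the commutator; each step adds one term, and the sum stays in
product form. -/
theorem E_highestWeightFamily_succ (hq0 : 0 < q) (hq1 : q < 1) (hΛ : 0 < Λ) (hE : T.E v = 0)
    (hK : T.K v = (Λ : ℂ) • v) (k : ℕ) :
    T.E (T.highestWeightFamily v (k + 1)) =
      (((1 - Λ ^ 2 * (q ^ 2) ^ k) / ((1 - q ^ 2) * (Λ * (q ^ 2) ^ k)) : ℝ) : ℂ) •
        T.highestWeightFamily v k := by
  have ht1 : q ^ 2 < 1 := pow_lt_one₀ hq0.le hq1 two_ne_zero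
  have h2 := (sub_pos.2 ht1).ne'
  have h3 : (q : ℂ)⁻¹ - q = (((1 - q ^ 2) / q : ℝ) : ℂ) := by
    have : (q : ℂ) ≠ 0 := by exact_mod_cast hq0.ne'
    push_cast
    field_simp
  induction k with
  | zero =>
    have h1 := (one_sub_pow_pos (t := q ^ 2) (by positivity) ht1 0).ne'
    rw [highestWeightFamily_succ, map_smul, E_F_apply (by positivity) (K_highestWeightFamily hK 0),
      E_highestWeightFamily_zero hE, map_zero, zero_add (_ • _), smul_smul, h3]
    congr 1
    norm_cast
    simp only [pow_zero, zero_add, pow_one, mul_one] at h1 ⊢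
    field_simp
    ring
  | succ k ih =>
    have h1 := (one_sub_pow_pos (t := q ^ 2) (by positivity) ht1 k).ne'
    have h4 := (one_sub_pow_pos (t := q ^ 2) (by positivity) ht1 (k + 1)).ne'
    rw [highestWeightFamily_succ, map_smul, E_F_apply (by positivity) (K_highestWeightFamily hK _),
      ih, map_smul, F_highestWeightFamily hq0 hq1, smul_smul, ← add_smul, smul_smul, h3]
    congr 1
    norm_cast
    field_simp
    ring

/-- Comparing `E` with its adjoint on neighbouring vectors yields the recurrence of `qBinomCoeff`.
-/
theorem norm_sq_highestWeightFamily (hq0 : 0 < q) (hq1 : q < 1) (hΛ : 0 < Λ) (hv : v ≠ 0)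
    (hE : T.E v = 0) (hK : T.K v = (Λ : ℂ) • v) (k : ℕ) :
    ‖T.highestWeightFamily v k‖ ^ 2 = qBinomCoeff (Λ ^ 2) (q ^ 2) k := by
  have ht1 : q ^ 2 < 1 := pow_lt_one₀ hq0.le hq1 two_ne_zero
  have h2 := (sub_pos.2 ht1).ne'
  induction k with
  | zero =>
    have : ‖v‖ ≠ 0 := norm_ne_zero_iff.2 hv
    rw [highestWeightFamily, norm_smul, Complex.norm_real, norm_inv, norm_norm,
      inv_mul_cancel₀ this, qBinomCoeff]
    simp
  | succ k ih =>
    have h1 := (one_sub_pow_pos (t := q ^ 2) (by positivity) ht1 k).ne'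
    have h4 := mul_norm_sq_eq (by positivity) (K_highestWeightFamily hK (k + 1))
      (E_highestWeightFamily_succ hq0 hq1 hΛ hE hK k) (F_highestWeightFamily hq0 hq1 k)
    have h5 := qBinomCoeff_succ (B := Λ ^ 2) (t := q ^ 2) (by positivity) ht1 k
    rw [ih] at h4
    refine mul_right_cancel₀ h1 ?_
    rw [h5]
    field_simp at h4
    refine mul_right_cancel₀ (b := (q ^ 2) ^ (k + 1)) (by positivity) ?_
    linear_combination -h4

theorem isWeightFamily_highestWeightFamily (hq0 : 0 < q) (hq1 : q < 1) (hΛ : 0 < Λ) (hΛ1 : Λ < 1)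
    (hv : v ≠ 0) (hE : T.E v = 0) (hK : T.K v = (Λ : ℂ) • v) :
    IsWeightFamily T (T.highestWeightFamily v) fun k => Λ * (q ^ 2) ^ k where
  injective := fun i j hij => by
    have ht1 : q ^ 2 < 1 := pow_lt_one₀ hq0.le hq1 two_ne_zero
    exact (pow_right_strictAnti₀ (by positivity) ht1).injective (mul_left_cancel₀ hΛ.ne' hij)
  weight_ne_zero := fun i => by positivity
  ne_zero := fun i h => by
    have ht1 : q ^ 2 < 1 := pow_lt_one₀ hq0.le hq1 two_ne_zero
    have h1 := norm_sq_highestWeightFamily hq0 hq1 hΛ hv hE hK i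
    have h2 := qBinomCoeff_pos (B := Λ ^ 2) (t := q ^ 2) (by positivity) ht1
      (pow_lt_one₀ hΛ.le hΛ1 two_ne_zero) i
    rw [h, norm_zero] at h1
    rw [← h1] at h2
    simp at h2
  K_apply := K_highestWeightFamily hK
  E_mem := fun i => by
    cases i with
    | zero =>
      rw [E_highestWeightFamily_zero hE]
      exact Submodule.zero_mem _
    | succ k =>
      rw [E_highestWeightFamily_succ hq0 hq1 hΛ hE hK]
      exact Submodule.smul_mem _ _ (Submodule.subset_span ⟨k, rfl⟩)
  F_mem := fun i => by
    rw [F_highestWeightFamily hq0 hq1]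
    exact Submodule.smul_mem _ _ (Submodule.subset_span ⟨i + 1, rfl⟩)

/-- The scaling in `highestWeightFamily` is chosen for this: qx - c contributes the factor 1 - Λ²
q^(2k), which cancels the one in the `E` coefficient. Since Λ < 1 it never vanishes, so qx - c is
invertible. -/
theorem zeta_highestWeightFamily (hq0 : 0 < q) (hq1 : q < 1) (hΛ : 0 < Λ) (hΛ1 : Λ < 1)
    (hT : T.IsIrreducible) (hv : v ≠ 0) (hE : T.E v = 0) (hK : T.K v = (Λ : ℂ) • v) :
    ((q / Λ : ℝ) : ℂ) • T.zeta 1 (q / Λ) (T.highestWeightFamily v 0) = 0 ∧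
    ∀ k, ((q / Λ : ℝ) : ℂ) • T.zeta 1 (q / Λ) (T.highestWeightFamily v (k + 1)) =
      T.highestWeightFamily v k := by
  have ht1 : q ^ 2 < 1 := pow_lt_one₀ hq0.le hq1 two_ne_zero
  have W := isWeightFamily_highestWeightFamily hq0 hq1 hΛ hΛ1 hv hE hK
  have hlt : ∀ k : ℕ, 0 < 1 - Λ ^ 2 * (q ^ 2) ^ k := fun k =>
    one_sub_mul_pow_pos (by positivity) ht1 (pow_lt_one₀ hΛ.le hΛ1 two_ne_zero) k
  have hne : ∀ k : ℕ, q * (1 * (Λ * (q ^ 2) ^ k)) ≠ q / Λ := by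
    intro k h
    rw [eq_div_iff hΛ.ne'] at h
    have h1 := hlt k
    have h2 : q * (1 - Λ ^ 2 * (q ^ 2) ^ k) = 0 := by linear_combination -h
    rcases mul_eq_zero.1 h2 with h3 | h3
    · exact hq0.ne' h3
    · exact h1.ne' h3
  constructor
  · rw [W.zeta_apply hT hne (γ := 0) (v := T.highestWeightFamily v 0) (κ' := Λ * (q ^ 2) ^ 0)
      (by rw [E_highestWeightFamily_zero hE]; simp) (K_highestWeightFamily hK 0) (hne 0)]
    simp
  · intro k
    rw [W.zeta_apply hT hne (E_highestWeightFamily_succ hq0 hq1 hΛ hE hK k)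
      (K_highestWeightFamily hK k) (hne k), smul_smul, ← Complex.ofReal_mul]
    have h1 := (hlt k).ne'
    have h2 := (sub_pos.2 ht1).ne'
    have h4 : q * (1 * (Λ * (q ^ 2) ^ k)) - q / Λ = -(q / Λ) * (1 - Λ ^ 2 * (q ^ 2) ^ k) := by
      field_simp
      ring
    have h3 : q / Λ * (-(1 - q ^ 2) * 1 * (Λ * (q ^ 2) ^ k) *
        ((1 - Λ ^ 2 * (q ^ 2) ^ k) / ((1 - q ^ 2) * (Λ * (q ^ 2) ^ k))) /
        (q * (1 * (Λ * (q ^ 2) ^ k)) - q / Λ)) = 1 := by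
      rw [h4]
      field_simp
    rw [h3, Complex.ofReal_one, one_smul]

end HighestWeight

end UqSU11Rep

/-! ### The realization in the unit disc. -/

theorem circularSetting_disc {q : ℝ} (hq0 : 0 < q) (hq1 : q < 1) {ν : Measure ℂ} {w : ℕ → ℝ}
    {M : ℕ → ℝ} (hw : ∀ k, 0 ≤ w k)
    (hν : ν = Measure.sum fun k : ℕ => ENNReal.ofReal (w k) • circleMeasure (q ^ k))
    (hM : ∀ n, 0 < M n) (hmom : ∀ n : ℕ, HasSum (fun k => w k * ((q ^ 2) ^ k) ^ n) (M n)) :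
    CircularSetting (Metric.ball 0 1) ν (fun n : ℕ => (n : ℤ)) (fun k => q ^ k) w M where
  isOpen := Metric.isOpen_ball
  conj_mem := fun z hz => by simpa using hz
  r_pos := fun k => pow_pos hq0 k
  w_nonneg := hw
  measure_eq := hν
  injective := Nat.cast_injective
  M_pos := hM
  moment := fun n => (hmom n).congr_fun fun k => by
    rw [zpow_mul, zpow_natCast, zpow_ofNat]
    ring
  sphere_subset := fun k _ => by
    rw [closure_ball _ one_ne_zero]
    exact Metric.sphere_subset_closedBall.trans
      (Metric.closedBall_subset_closedBall (pow_le_one₀ hq0.le hq1.le))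
  isHolCont_zpow := fun n => by
    simp only [zpow_natCast]
    exact ⟨(differentiable_pow n).differentiableOn, (continuous_pow n).continuousOn⟩
  coeff := fun g hg => by
    have hg2 := hg.2
    rw [closure_ball _ one_ne_zero] at hg2
    have h1 : ∀ (k : ℕ) (n : ℤ), laurentCoeff g (q ^ k) n = laurentCoeff g 1 n := fun k n =>
      laurentCoeff_eq_of_annulus (pow_pos hq0 k) (pow_le_one₀ hq0.le hq1.le)
        (hg2.mono Set.sdiff_subset) (hg.1.mono Set.sdiff_subset) n
    refine ⟨fun n => laurentCoeff g 1 n, fun k _ => ⟨fun n => h1 k n, fun n hn => ?_⟩⟩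
    rw [h1]
    refine laurentCoeff_eq_zero_of_neg hg2 hg.1 ?_
    by_contra hcon
    exact hn ⟨n.toNat, Int.toNat_of_nonneg (not_lt.1 hcon)⟩

theorem circularSetting_discMeasure {q l : ℝ} (hq0 : 0 < q) (hq1 : q < 1) (hl : l ≤ -1 / 2) :
    ∃ w : ℕ → ℝ, CircularSetting (Metric.ball 0 1) (discMeasure q l) (fun n : ℕ => (n : ℤ))
      (fun k => q ^ k) w fun n => (qBinomCoeff ((q ^ (-2 * l)) ^ 2) (q ^ 2) n)⁻¹ := by
  have ht1 : q ^ 2 < 1 := pow_lt_one₀ hq0.le hq1 two_ne_zero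
  have ht0 : 0 < q ^ 2 := by positivity
  have hΛ1 : q ^ (-2 * l) < 1 := Real.rpow_lt_one hq0.le hq1 (by linarith)
  have hM : ∀ n, 0 < (qBinomCoeff ((q ^ (-2 * l)) ^ 2) (q ^ 2) n)⁻¹ := fun n =>
    inv_pos.2 (qBinomCoeff_pos ht0 ht1
      (pow_lt_one₀ (Real.rpow_pos_of_pos hq0 _).le hΛ1 two_ne_zero) n)
  rcases hl.lt_or_eq with h | h
  · have hb0 : 0 < q ^ (-2 * (2 * l + 1)) := Real.rpow_pos_of_pos hq0 _
    have hb1 : q ^ (-2 * (2 * l + 1)) < 1 := Real.rpow_lt_one hq0.le hq1 (by linarith)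
    -- The moment formula with parameter b yields coefficients with parameter b t; this identifies b
    -- t with Λ².
    have hbt : q ^ (-2 * (2 * l + 1)) * q ^ 2 = (q ^ (-2 * l)) ^ 2 := by
      rw [← Real.rpow_natCast q 2, ← Real.rpow_add hq0, ← Real.rpow_mul_natCast hq0.le]
      congr 1
      push_cast
      ring
    have hpos : ∀ a : ℝ, 0 < a → a < 1 → 0 < qPochInfReal a (q ^ 2) := by
      intro a ha0 ha1
      have htn : ‖q ^ 2‖ < 1 := by rwa [Real.norm_of_nonneg ht0.le]
      refine lt_of_le_of_ne (ge_of_tendsto' (tendsto_prod_one_sub_mul_pow htn a) fun n =>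
        Finset.prod_nonneg fun k _ => (one_sub_mul_pow_pos ht0 ht1 ha1 k).le)
        (tprod_one_sub_mul_pow_ne_zero htn fun k => (one_sub_mul_pow_pos ht0 ht1 ha1 k).ne').symm
    have hbk : ∀ k : ℕ, q ^ (2 * ((k : ℝ) - 2 * l - 1)) =
        q ^ (-2 * (2 * l + 1)) * (q ^ 2) ^ k := by
      intro k
      rw [← pow_mul, ← Real.rpow_natCast q (2 * k), ← Real.rpow_add hq0]
      congr 1
      push_cast
      ring
    have hnn : ∀ k : ℕ, 0 ≤ (q ^ 2) ^ k * (qPochInfReal ((q ^ 2) ^ (k + 1)) (q ^ 2) /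
        qPochInfReal (q ^ (-2 * (2 * l + 1)) * (q ^ 2) ^ k) (q ^ 2)) := by
      intro k
      have h1 := hpos ((q ^ 2) ^ (k + 1)) (by positivity)
        (pow_lt_one₀ ht0.le ht1 (Nat.succ_ne_zero k))
      have h2 := hpos (q ^ (-2 * (2 * l + 1)) * (q ^ 2) ^ k) (by positivity) (by
        have := one_sub_mul_pow_pos ht0 ht1 hb1 k
        have := pow_le_one₀ (n := k) ht0.le ht1.le
        nlinarith)
      positivity
    refine ⟨fun k => (1 - q ^ (-2 * (2 * l + 1))) * ((q ^ 2) ^ k *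
      (qPochInfReal ((q ^ 2) ^ (k + 1)) (q ^ 2) /
        qPochInfReal (q ^ (-2 * (2 * l + 1)) * (q ^ 2) ^ k) (q ^ 2))),
      circularSetting_disc hq0 hq1 (fun k => mul_nonneg (sub_nonneg.2 hb1.le) (hnn k)) ?_ hM
        fun n => ?_⟩
    · rw [discMeasure, if_pos h]
      ext s hs
      rw [Measure.smul_apply, Measure.sum_apply _ hs, Measure.sum_apply _ hs, smul_eq_mul,
        ← ENNReal.tsum_mul_left]
      refine tsum_congr fun k => ?_
      rw [Measure.smul_apply, Measure.smul_apply, smul_eq_mul, smul_eq_mul, ← mul_assoc,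
        ← ENNReal.ofReal_mul (sub_nonneg.2 hb1.le), hbk, pow_mul, pow_mul, mul_div_assoc]
    · rw [← hbt]
      exact hasSum_qBinomCoeff_moment ht0 ht1 hb1 n
  -- At l = -1/2 the parameter Λ² equals q², all coefficients are 1, and the space is the Hardy
  -- space: a single circle of weight 1 suffices.
  · have hc : ∀ n, qBinomCoeff ((q ^ (-2 * l)) ^ 2) (q ^ 2) n = 1 := by
      intro n
      have h1 : q ^ (-2 * l) = q := by
        rw [h]
        norm_num
      rw [h1]
      refine Finset.prod_eq_one fun j _ => ?_
      rw [← pow_succ', div_self (one_sub_pow_pos ht0 ht1 j).ne']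
    refine ⟨fun k => if k = 0 then 1 else 0, circularSetting_disc hq0 hq1
      (fun k => by split_ifs <;> norm_num) ?_ hM fun n => ?_⟩
    · rw [discMeasure, if_neg h.not_lt]
      ext s hs
      rw [Measure.sum_apply _ hs, tsum_eq_single 0]
      · simp
      · intro k hk
        simp [hk]
    · rw [hc, inv_one]
      have := hasSum_single (f := fun k : ℕ => (if k = 0 then (1 : ℝ) else 0) * ((q ^ 2) ^ k) ^ n) 0
        (fun k hk => by simp [hk])
      simpa using this

namespace UqSU11Rep

variable {q : ℝ} {H : Type*} [NormedAddCommGroup H] [InnerProductSpace ℂ H]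
  {T : UqSU11Rep q H}

theorem coherentSystem_highestWeightFamily {Λ : ℝ} {v : T.dom} (hq0 : 0 < q) (hq1 : q < 1)
    (hΛ : 0 < Λ) (hΛ1 : Λ < 1) (hT : T.IsIrreducible) (hv : v ≠ 0) (hE : T.E v = 0)
    (hK : T.K v = (Λ : ℂ) • v) :
    CoherentSystem (Metric.ball 0 1) (fun n : ℕ => (n : ℤ))
      (fun n => (qBinomCoeff (Λ ^ 2) (q ^ 2) n)⁻¹) fun n => (T.highestWeightFamily v n : H) where
  inner_eq_zero := fun i j hij =>
    (isWeightFamily_highestWeightFamily hq0 hq1 hΛ hΛ1 hv hE hK).inner_eq_zero hij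
  norm_sq_mul := fun n => by
    rw [← Submodule.coe_norm, norm_sq_highestWeightFamily hq0 hq1 hΛ hv hE hK]
    exact mul_inv_cancel₀ (qBinomCoeff_pos (by positivity)
      (pow_lt_one₀ hq0.le hq1 two_ne_zero) (pow_lt_one₀ hΛ.le hΛ1 two_ne_zero) n).ne'
  dense_span :=
    (isWeightFamily_highestWeightFamily hq0 hq1 hΛ hΛ1 hv hE hK).topologicalClosure_span_eq_top hT
  bound := fun z hz => by
    rw [mem_ball_zero_iff] at hz
    obtain ⟨ρ, hρ0, hρ1⟩ := exists_between hz
    have hρ : 0 < ρ := (norm_nonneg z).trans_lt hρ0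
    -- The squared norms are known, so ‖f_n‖ ≤ ‖f_n‖² + 1 is used to avoid square roots in the
    -- majorant.
    refine ⟨Metric.ball 0 ρ, Metric.isOpen_ball, by simpa using hρ0,
      fun n => (qBinomCoeff (Λ ^ 2) (q ^ 2) n * ρ ^ n + ρ ^ n),
      (summable_qBinomCoeff_mul_pow (by positivity) (pow_lt_one₀ hq0.le hq1 two_ne_zero)
        (pow_lt_one₀ hΛ.le hΛ1 two_ne_zero) hρ.le hρ1).add
        (summable_geometric_of_lt_one hρ.le hρ1), fun n x hx => ?_⟩
    rw [mem_ball_zero_iff] at hx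
    beta_reduce
    rw [zpow_natCast, norm_pow, ← Submodule.coe_norm,
      ← norm_sq_highestWeightFamily hq0 hq1 hΛ hv hE hK]
    have h1 : ‖x‖ ^ n ≤ ρ ^ n := pow_le_pow_left₀ (norm_nonneg x) hx.le n
    have h2 : ‖T.highestWeightFamily v n‖ ≤ ‖T.highestWeightFamily v n‖ ^ 2 + 1 := by
      nlinarith [sq_nonneg (‖T.highestWeightFamily v n‖ - 1)]
    calc ‖x‖ ^ n * ‖T.highestWeightFamily v n‖
        ≤ ρ ^ n * (‖T.highestWeightFamily v n‖ ^ 2 + 1) := by gcongr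
      _ = _ := by ring

/-- The q-binomial theorem with B = Λ² = (q²)^(-2l), which sums the reproducing kernel in closed
form. -/
theorem inv_qPoch_eq_tsum {l : ℝ} (hq0 : 0 < q) (hq1 : q < 1) (hl : l < 0) {z : ℂ} (hz : ‖z‖ < 1) :
    1 / qPoch z (q ^ 2) (-2 * l) =
      ∑' n : ℕ, (qBinomCoeff ((q ^ (-2 * l)) ^ 2) (q ^ 2) n : ℂ) * z ^ n := by
  have ht1 : q ^ 2 < 1 := pow_lt_one₀ hq0.le hq1 two_ne_zero
  have ht0 : 0 < q ^ 2 := by positivity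
  have hB : (q ^ (-2 * l)) ^ 2 < 1 := pow_lt_one₀ (Real.rpow_pos_of_pos hq0 _).le
    (Real.rpow_lt_one hq0.le hq1 (by linarith)) two_ne_zero
  have htn : ‖((q ^ 2 : ℝ) : ℂ)‖ < 1 := by rwa [Complex.norm_real, Real.norm_of_nonneg ht0.le]
  have hBt : (q ^ 2 : ℝ) ^ (-2 * l) = (q ^ (-2 * l)) ^ 2 := by
    rw [← Real.rpow_natCast, ← Real.rpow_natCast, ← Real.rpow_mul hq0.le, ← Real.rpow_mul hq0.le,
      mul_comm]
  have h1 := tsum_mul_tprod_eq_of_recurrence (t := ((q ^ 2 : ℝ) : ℂ))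
    (B := (((q ^ (-2 * l)) ^ 2 : ℝ) : ℂ)) (z := z)
    (c := fun n => (qBinomCoeff ((q ^ (-2 * l)) ^ 2) (q ^ 2) n : ℂ)) htn (by simp [qBinomCoeff])
    (fun k => by exact_mod_cast qBinomCoeff_succ ht0 ht1 k)
    ((summable_qBinomCoeff_mul_pow ht0 ht1 hB (norm_nonneg z) hz).congr fun k => by
      rw [norm_mul, norm_pow, Complex.norm_real,
        Real.norm_of_nonneg (qBinomCoeff_pos ht0 ht1 hB k).le])
  have h2 : qPochInf z ((q ^ 2 : ℝ) : ℂ) ≠ 0 := by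
    refine tprod_one_sub_mul_pow_ne_zero htn fun k h => ?_
    have h3 : ‖z * ((q ^ 2 : ℝ) : ℂ) ^ k‖ < 1 := by
      rw [norm_mul, norm_pow]
      exact (mul_le_of_le_one_right (norm_nonneg z)
        (pow_le_one₀ (norm_nonneg _) htn.le)).trans_lt hz
    rw [← sub_eq_zero.1 h, norm_one] at h3
    exact lt_irrefl _ h3
  rw [qPoch, hBt, one_div_div, div_eq_iff h2, mul_comm z]
  exact h1.symm

/-- The realization of the holomorphic discrete series in the unit disc. -/
theorem exists_discRealization [CompleteSpace H] (hq0 : 0 < q) (hq1 : q < 1) {l ε : ℝ}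
    (hl : l ≤ -1 / 2) (hT : T.IsHolomorphicDiscrete l ε) :
    ∃ Θ : ℂ → H,
      DifferentiableOn ℂ Θ (Metric.ball 0 1) ∧
      (∀ z ∈ Metric.ball (0 : ℂ) 1,
        (Θ z, z • Θ z) ∈ (T.zetaClosed 1 (q ^ (2 * l + 1))).graph) ∧
      (∀ z ∈ Metric.ball (0 : ℂ) 1, ∀ w ∈ Metric.ball (0 : ℂ) 1,
        inner ℂ (Θ w) (Θ z) = 1 / qPoch (z * starRingEnd ℂ w) (q ^ 2) (-2 * l)) ∧
      IsHolomorphicRealization Θ (Metric.ball 0 1) (discMeasure q l) := by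
  obtain ⟨-, -, hirr, v, hv, hE, hK⟩ := hT
  have hΛ : 0 < q ^ (-2 * l) := Real.rpow_pos_of_pos hq0 _
  have hΛ1 : q ^ (-2 * l) < 1 := Real.rpow_lt_one hq0.le hq1 (by linarith)
  have hc : q ^ (2 * l + 1) = q / q ^ (-2 * l) := by
    rw [Real.rpow_add_one hq0.ne', div_eq_mul_inv, ← Real.rpow_neg hq0.le, mul_comm]
    congr 2
    ring
  obtain ⟨w, S⟩ := circularSetting_discMeasure hq0 hq1 hl
  have W := isWeightFamily_highestWeightFamily hq0 hq1 hΛ hΛ1 hv hE hK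
  have C := coherentSystem_highestWeightFamily hq0 hq1 hΛ hΛ1 hirr hv hE hK
  obtain ⟨hz0, hz1⟩ := zeta_highestWeightFamily hq0 hq1 hΛ hΛ1 hirr hv hE hK
  refine ⟨fun z => ∑' n : ℕ, z ^ (n : ℤ) • (T.highestWeightFamily v n : H),
    C.differentiableOn (fun n => (S.isHolCont_zpow n).1) S.isOpen, fun z hz => ?_,
    fun z hz x hx => ?_, C.isHolomorphicRealization S⟩
  · rw [hc]
    have hsum := (C.summable hz).hasSum
    refine W.mem_graph_zetaClosed hirr (fun i => ?_) hsum ?_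
    -- The adjoint of the backward shift is a forward shift; the ratio of squared norms compensates
    -- for the basis being merely orthogonal.
    · refine ⟨(((‖T.highestWeightFamily v i‖ ^ 2 / ‖T.highestWeightFamily v (i + 1)‖ ^ 2 : ℝ)) : ℂ) •
        (T.highestWeightFamily v (i + 1) : H), fun j => ?_⟩
      cases j with
      | zero =>
        rw [hz0, inner_smul_left, W.inner_eq_zero (Nat.succ_ne_zero i), mul_zero]
        simp
      | succ j =>
        rw [hz1, inner_smul_left]
        by_cases hij : i = j
        · subst hij
          have h1 : (‖T.highestWeightFamily v (i + 1)‖ : ℂ) ≠ 0 := by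
            exact_mod_cast norm_ne_zero_iff.2 (W.ne_zero (i + 1))
          rw [inner_self_eq_norm_sq_to_K, inner_self_eq_norm_sq_to_K, Complex.conj_ofReal,
            ← Submodule.coe_norm, ← Submodule.coe_norm]
          simp only [Complex.coe_algebraMap]
          push_cast
          field_simp
        · rw [W.inner_eq_zero hij, W.inner_eq_zero (fun h => hij (Nat.succ_injective h)), mul_zero]
    · rw [← hasSum_nat_add_iff' 1]
      simp only [Finset.range_one, Finset.sum_singleton, hz0, hz1, Submodule.coe_zero, smul_zero,
        sub_zero]
      refine (hsum.const_smul z).congr_fun fun n => ?_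
      rw [smul_smul, zpow_natCast, zpow_natCast, pow_succ']
  · have h1 := C.hasSum_inner hz hx
    have h2 : ‖z * starRingEnd ℂ x‖ < 1 := by
      rw [mem_ball_zero_iff] at hz hx
      rw [norm_mul, RCLike.norm_conj]
      exact mul_lt_one_of_nonneg_of_lt_one_left (norm_nonneg z) hz hx.le
    rw [inv_qPoch_eq_tsum hq0 hq1 (by linarith) h2, ← h1.tsum_eq]
    refine tsum_congr fun n => ?_
    rw [← Submodule.coe_norm, norm_sq_highestWeightFamily hq0 hq1 hΛ hv hE hK, zpow_natCast]

end UqSU11Rep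

/-! ### The strange series: two-sided ladders and the Casimir element. -/

/-- A ladder of vectors, indexed by the integers, for a pair of operators that are inverse to each
other up to scalars on a chain of subspaces. -/
theorem exists_int_ladder {V : Type*} [AddCommGroup V] [Module ℂ V] (E F : Module.End ℂ V)
    (S : ℤ → Submodule ℂ V) (γ φ : ℤ → ℂ) (hγ : ∀ k, γ k ≠ 0) (hφ : ∀ k, φ k ≠ 0)
    (hE : ∀ k, ∀ u ∈ S (k + 1), E u ∈ S k) (hF : ∀ k, ∀ u ∈ S k, F u ∈ S (k + 1))
    (hFE : ∀ k, ∀ u ∈ S (k + 1), F (E u) = (γ (k + 1) * φ (k + 1)) • u)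
    (hEF : ∀ k, ∀ u ∈ S k, E (F u) = (γ (k + 1) * φ (k + 1)) • u) {v : V} (hv : v ∈ S 0) :
    ∃ f : ℤ → V, f 0 = v ∧ (∀ k, f k ∈ S k) ∧ (∀ k, E (f (k + 1)) = γ (k + 1) • f k) ∧
      ∀ k, F (f k) = φ (k + 1) • f (k + 1) := by
  -- The upper half solves the `F` relation and the lower half the `E` relation; the other relation
  -- on each half follows from `hEF` and `hFE`.
  let up : ℕ → V := fun n => Nat.rec v (fun n u => (φ (n + 1))⁻¹ • F u) n
  let down : ℕ → V := fun n => Nat.rec v (fun n u => (γ (-n))⁻¹ • E u) n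
  have hup : ∀ n : ℕ, up (n + 1) = (φ (n + 1))⁻¹ • F (up n) := fun n => rfl
  have hdown : ∀ n : ℕ, down (n + 1) = (γ (-n))⁻¹ • E (down n) := fun n => rfl
  have hupS : ∀ n : ℕ, up n ∈ S n := by
    intro n
    induction n with
    | zero => exact hv
    | succ n ih =>
      rw [hup]
      exact Submodule.smul_mem _ _ (by exact_mod_cast hF n _ ih)
  have hdownS : ∀ n : ℕ, down n ∈ S (-n) := by
    intro n
    induction n with
    | zero => exact hv
    | succ n ih =>
      rw [hdown]
      refine Submodule.smul_mem _ _ (hE _ _ ?_)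
      convert ih using 2
      push_cast
      ring
  -- `Int.negSucc n` is -(n + 1), hence the shift in `down`.
  let f : ℤ → V := fun k => Int.casesOn k up fun n => down (n + 1)
  have fup : ∀ n : ℕ, f n = up n := fun n => rfl
  have fdown : ∀ n : ℕ, f (-n) = down n := by
    intro n
    cases n with
    | zero => rfl
    | succ n => rfl
  have hcases : ∀ k : ℤ, (∃ n : ℕ, k = n) ∨ ∃ n : ℕ, k = -(n : ℤ) - 1 := by
    intro k
    rcases le_or_gt 0 k with h | h
    · exact Or.inl ⟨k.toNat, by omega⟩
    · exact Or.inr ⟨(-k - 1).toNat, by omega⟩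
  have e1 : ∀ n : ℕ, f (-(n : ℤ) - 1) = down (n + 1) := by
    intro n
    have h : -(n : ℤ) - 1 = -((n + 1 : ℕ) : ℤ) := by
      push_cast
      ring
    rw [h]
    exact fdown (n + 1)
  refine ⟨f, rfl, fun k => ?_, fun k => ?_, fun k => ?_⟩
  · rcases hcases k with ⟨n, rfl⟩ | ⟨n, rfl⟩
    · exact hupS n
    · rw [e1]
      convert hdownS (n + 1) using 2
      push_cast
      ring
  · rcases hcases k with ⟨n, rfl⟩ | ⟨n, rfl⟩
    · have h1 : f ((n : ℤ) + 1) = up (n + 1) := by exact_mod_cast fup (n + 1)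
      rw [h1, hup, map_smul, hEF _ _ (hupS n), smul_smul, fup]
      congr 1
      have := hφ (n + 1)
      field_simp
    · rw [sub_add_cancel, fdown, e1, hdown, smul_smul, mul_inv_cancel₀ (hγ _), one_smul]
  · rcases hcases k with ⟨n, rfl⟩ | ⟨n, rfl⟩
    · have h1 : f ((n : ℤ) + 1) = up (n + 1) := by exact_mod_cast fup (n + 1)
      rw [h1, hup, smul_smul, mul_inv_cancel₀ (hφ _), one_smul, fup]
    · have h2 := hFE (-(n : ℤ) - 1) (down n) (by
        rw [sub_add_cancel]
        exact hdownS n)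
      rw [sub_add_cancel] at h2 ⊢
      rw [fdown, e1, hdown, map_smul, h2, smul_smul]
      congr 1
      have := hγ (-n)
      field_simp

theorem cpow_pi_mul_I_div_two_mul_log {q : ℝ} (hq0 : 0 < q) (hq1 : q < 1) :
    (q : ℂ) ^ ((Real.pi : ℂ) * I / (2 * Real.log q)) = I := by
  have h1 : (q : ℂ) ≠ 0 := by exact_mod_cast hq0.ne'
  have h2 : (Real.log q : ℂ) ≠ 0 := by exact_mod_cast (Real.log_neg hq0 hq1).ne
  rw [Complex.cpow_def_of_ne_zero h1, ← Complex.ofReal_log hq0.le]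
  have h3 : (Real.log q : ℂ) * ((Real.pi : ℂ) * I / (2 * Real.log q)) = Real.pi / 2 * I := by
    field_simp
  rw [h3, Complex.exp_pi_div_two_mul_I]

namespace UqSU11Rep

variable {q : ℝ} {H : Type*} [NormedAddCommGroup H] [InnerProductSpace ℂ H]
  {T : UqSU11Rep q H}

/-- The imaginary part of the spin gives q^l = i q^α, which turns the value real, with q^N entering
through q^(2α+1). -/
theorem casimirValue_strange (hq0 : 0 < q) (hq1 : q < 1) {α : ℝ} {N : ℕ} (hα : 2 * α + 1 = N) :
    casimirValue q ((α : ℂ) + Real.pi * Complex.I / (2 * Real.log q)) =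
      ((-(q ^ N + (q ^ N)⁻¹ + q + q⁻¹) / (q⁻¹ - q) ^ 2 : ℝ) : ℂ) := by
  have h1 : (q : ℂ) ≠ 0 := by exact_mod_cast hq0.ne'
  have hA : q ^ α * q ^ α * q = q ^ N := by
    rw [← Real.rpow_add hq0, ← Real.rpow_add_one hq0.ne', ← Real.rpow_natCast, ← hα]
    congr 1
    ring
  have hp : q ^ α ≠ 0 := (Real.rpow_pos_of_pos hq0 _).ne'
  have hpc : ((q ^ α : ℝ) : ℂ) ≠ 0 := by exact_mod_cast hp
  set l : ℂ := (α : ℂ) + Real.pi * Complex.I / (2 * Real.log q) with hl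
  have e1 : (q : ℂ) ^ l = ((q ^ α : ℝ) : ℂ) * I := by
    rw [hl, Complex.cpow_add _ _ h1, cpow_pi_mul_I_div_two_mul_log hq0 hq1,
      Complex.ofReal_cpow hq0.le]
  have e2 : (q : ℂ) ^ (-l) = -((q ^ α : ℝ) : ℂ)⁻¹ * I := by
    rw [Complex.cpow_neg, e1, mul_inv, Complex.inv_I]
    ring
  have e3 : (q : ℂ) ^ (l + 1) = ((q ^ α : ℝ) : ℂ) * I * q := by
    rw [Complex.cpow_add _ _ h1, e1, Complex.cpow_one]
  have e4 : (q : ℂ) ^ (-l - 1) = -((q ^ α : ℝ) : ℂ)⁻¹ * I * (q : ℂ)⁻¹ := by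
    rw [Complex.cpow_sub _ _ h1, e2, Complex.cpow_one, div_eq_mul_inv]
  rw [casimirValue, e1, e2, e3, e4, ← hA]
  push_cast
  generalize ((q ^ α : ℝ) : ℂ) = P at *
  congr 1
  field_simp
  ring_nf
  simp only [Complex.I_sq]
  ring

section Strange

variable {κ A : ℝ} {u : T.dom}

/-- On a weight vector `E F - F E` is a known scalar, so the Casimir element, which contains the
symmetrized product, determines `F E` alone. -/
theorem F_E_apply_of_casimir (hq0 : 0 < q) (hq1 : q < 1) (hκ : κ ≠ 0) (hK : T.K u = (κ : ℂ) • u)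
    (hC : T.casimir u = ((-(A + A⁻¹ + q + q⁻¹) / (q⁻¹ - q) ^ 2 : ℝ) : ℂ) • u) :
    T.F (T.E u) = ((-(A + A⁻¹ + q / κ + κ / q) / (q⁻¹ - q) ^ 2 : ℝ) : ℂ) • u := by
  have h1 := E_F_apply hκ hK
  simp only [casimir, LinearMap.add_apply, LinearMap.smul_apply, Module.End.mul_apply,
    LinearMap.sub_apply, Module.End.one_apply, hK, Kinv_apply_of_K_apply hκ hK, h1] at hC
  have hqq : (q⁻¹ - q : ℝ) ≠ 0 := by
    have : 1 < q⁻¹ := (one_lt_inv₀ hq0).2 hq1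
    linarith
  have hqqc : ((q : ℂ)⁻¹ - q) ≠ 0 := by exact_mod_cast hqq
  have hqc : (q : ℂ) ≠ 0 := by exact_mod_cast hq0.ne'
  have hκc : (κ : ℂ) ≠ 0 := by exact_mod_cast hκ
  have h2 : T.F (T.E u) = (((-(A + A⁻¹ + q + q⁻¹) / (q⁻¹ - q) ^ 2 : ℝ) : ℂ) -
      (2 : ℂ)⁻¹ * (((q : ℂ)⁻¹ - q)⁻¹ * ((κ : ℂ) - (κ : ℂ)⁻¹)) -
      (((q : ℂ)⁻¹ + q) / (2 * ((q : ℂ)⁻¹ - q) ^ 2)) * ((κ : ℂ) - 2 + (κ : ℂ)⁻¹)) • u := by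
    rw [sub_smul, sub_smul, ← hC]
    module
  rw [h2]
  congr 1
  push_cast
  generalize (A : ℂ) + (A : ℂ)⁻¹ = A' at *
  have h4 : (q : ℂ)⁻¹ - q = (1 - (q : ℂ) ^ 2) / q := by field_simp
  have h3 : (1 - (q : ℂ) ^ 2) ≠ 0 := by
    intro h
    rw [h4, h, zero_div] at hqqc
    exact hqqc rfl
  rw [h4]
  field_simp
  ring

/-- The basis of weight vectors of the strange series on which the normalized coordinate acts as a
shift. -/
theorem exists_strangeFamily (hq0 : 0 < q) (hq1 : q < 1) (hκ : 0 < κ) (hA : 0 < A)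
    (hC : ∀ u, T.casimir u = ((-(A + A⁻¹ + q + q⁻¹) / (q⁻¹ - q) ^ 2 : ℝ) : ℂ) • u)
    (hK : T.K u = (κ : ℂ) • u) :
    ∃ f : ℤ → T.dom, f 0 = u ∧ (∀ k, T.K (f k) = ((κ * (q ^ 2) ^ k : ℝ) : ℂ) • f k) ∧
      (∀ k, T.E (f (k + 1)) = ((-((1 + κ * q / A * (q ^ 2) ^ k) /
        ((1 - q ^ 2) * (κ * (q ^ 2) ^ k))) : ℝ) : ℂ) • f k) ∧
      ∀ k, T.F (f k) = ((q * (1 + κ * q * A * (q ^ 2) ^ k) / (1 - q ^ 2) : ℝ) : ℂ) •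
        f (k + 1) := by
  have ht1 : q ^ 2 < 1 := pow_lt_one₀ hq0.le hq1 two_ne_zero
  have ht2 : 0 < 1 - q ^ 2 := sub_pos.2 ht1
  have hqq : q⁻¹ - q = (1 - q ^ 2) / q := by field_simp
  have hpow : ∀ k : ℤ, (q ^ 2) ^ (k + 1) = (q ^ 2) ^ k * q ^ 2 := fun k =>
    zpow_add_one₀ (by positivity) k
  have hE : ∀ (k : ℤ) (w : T.dom), T.K w = ((κ * (q ^ 2) ^ (k + 1) : ℝ) : ℂ) • w →
      T.K (T.E w) = ((κ * (q ^ 2) ^ k : ℝ) : ℂ) • T.E w := by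
    intro k w hw
    rw [K_E_apply hw, hpow]
    congr 1
    have : (q : ℂ) ≠ 0 := by exact_mod_cast hq0.ne'
    push_cast
    field_simp
  have hF : ∀ (k : ℤ) (w : T.dom), T.K w = ((κ * (q ^ 2) ^ k : ℝ) : ℂ) • w →
      T.K (T.F w) = ((κ * (q ^ 2) ^ (k + 1) : ℝ) : ℂ) • T.F w := by
    intro k w hw
    rw [K_F_apply hw, hpow]
    congr 1
    push_cast
    ring
  -- With m = κ q^(2k+1), A + A⁻¹ + m + m⁻¹ = (1 + m/A)(1 + mA)/m. Both factors are positive, so the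
  -- ladder never stops. The factor 1 + m/A is assigned to `E` because it will cancel against qx - c
  -- for c = A, s = -1.
  have hscal : ∀ k : ℤ, -(A + A⁻¹ + q / (κ * (q ^ 2) ^ (k + 1)) + (κ * (q ^ 2) ^ (k + 1)) / q) /
      (q⁻¹ - q) ^ 2 = -((1 + κ * q / A * (q ^ 2) ^ k) / ((1 - q ^ 2) * (κ * (q ^ 2) ^ k))) *
        (q * (1 + κ * q * A * (q ^ 2) ^ k) / (1 - q ^ 2)) := by
    intro k
    rw [hpow, hqq]
    have : 0 < (q ^ 2) ^ k := by positivity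
    generalize (q ^ 2) ^ k = p at *
    field_simp
    ring
  obtain ⟨f, h0, hS, h1, h2⟩ := exists_int_ladder T.E T.F
    (fun k => LinearMap.ker (T.K - ((κ * (q ^ 2) ^ k : ℝ) : ℂ) • (1 : Module.End ℂ T.dom)))
    -- The ladder attaches the scalars of index k to the step between k - 1 and k, hence the
    -- exponent k - 1.
    (fun k => ((-((1 + κ * q / A * (q ^ 2) ^ (k - 1)) /
        ((1 - q ^ 2) * (κ * (q ^ 2) ^ (k - 1)))) : ℝ) : ℂ))
    (fun k => ((q * (1 + κ * q * A * (q ^ 2) ^ (k - 1)) / (1 - q ^ 2) : ℝ) : ℂ))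
    (fun k => by
      have : (0 : ℝ) < (1 + κ * q / A * (q ^ 2) ^ (k - 1)) /
        ((1 - q ^ 2) * (κ * (q ^ 2) ^ (k - 1))) := by positivity
      exact_mod_cast (neg_neg_of_pos this).ne)
    (fun k => by
      have : (0 : ℝ) < q * (1 + κ * q * A * (q ^ 2) ^ (k - 1)) / (1 - q ^ 2) := by positivity
      exact_mod_cast this.ne')
    (fun k w hw => by
      simp only [LinearMap.mem_ker, LinearMap.sub_apply, LinearMap.smul_apply,
        Module.End.one_apply, sub_eq_zero] at hw ⊢
      exact hE k w hw)
    (fun k w hw => by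
      simp only [LinearMap.mem_ker, LinearMap.sub_apply, LinearMap.smul_apply,
        Module.End.one_apply, sub_eq_zero] at hw ⊢
      exact hF k w hw)
    (fun k w hw => by
      simp only [LinearMap.mem_ker, LinearMap.sub_apply, LinearMap.smul_apply,
        Module.End.one_apply, sub_eq_zero] at hw
      rw [F_E_apply_of_casimir hq0 hq1 (by positivity) hw (hC w), hscal, add_sub_cancel_right,
        Complex.ofReal_mul])
    (fun k w hw => by
      simp only [LinearMap.mem_ker, LinearMap.sub_apply, LinearMap.smul_apply,
        Module.End.one_apply, sub_eq_zero] at hw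
      have hκk : κ * (q ^ 2) ^ k ≠ 0 := by positivity
      rw [E_F_apply hκk hw, F_E_apply_of_casimir hq0 hq1 hκk hw (hC w), add_sub_cancel_right,
        ← Complex.ofReal_mul, ← hscal, ← add_smul, hpow, hqq]
      congr 1
      have h3 : (q : ℂ)⁻¹ - q = (((1 - q ^ 2) / q : ℝ) : ℂ) := by
        rw [← hqq]
        push_cast
        ring
      rw [h3]
      norm_cast
      have : 0 < (q ^ 2) ^ k := by positivity
      generalize (q ^ 2) ^ k = p at *
      field_simp
      ring)
    (v := u) (by
      simp only [LinearMap.mem_ker, LinearMap.sub_apply, LinearMap.smul_apply,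
        Module.End.one_apply, sub_eq_zero, zpow_zero, mul_one]
      exact hK)
  refine ⟨f, h0, fun k => ?_, fun k => ?_, fun k => ?_⟩
  · have := hS k
    simp only [LinearMap.mem_ker, LinearMap.sub_apply, LinearMap.smul_apply,
      Module.End.one_apply, sub_eq_zero] at this
    exact this
  · have := h1 k
    rwa [add_sub_cancel_right] at this
  · have := h2 k
    rwa [add_sub_cancel_right] at this

end Strange

end UqSU11Rep

/-! ### Moments of the annulus measure. -/

/-- The moments `(a t ^ k; t)_N` of the measure of the strange series. -/
def annulusMoment (a t : ℝ) (N : ℕ) (k : ℤ) : ℝ :=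
  ∏ j ∈ Finset.range N, (1 - a * t ^ k * t ^ j)

section AnnulusMoment

variable {a t : ℝ} {N : ℕ}

/-- Both sides are the product of the same N + 1 factors, split off at opposite ends. -/
theorem annulusMoment_succ (ht0 : 0 < t) (k : ℤ) :
    annulusMoment a t N (k + 1) * (1 - a * t ^ k) =
      annulusMoment a t N k * (1 - a * t ^ k * t ^ N) := by
  have h1 : annulusMoment a t N (k + 1) =
      ∏ j ∈ Finset.range N, (1 - a * t ^ k * t ^ (j + 1)) := by
    refine Finset.prod_congr rfl fun j _ => ?_
    rw [zpow_add_one₀ ht0.ne']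
    ring
  have h2 : 1 - a * t ^ k = 1 - a * t ^ k * t ^ 0 := by simp
  rw [h1, h2]
  exact (Finset.prod_range_succ' (fun j => 1 - a * t ^ k * t ^ j) N).symm.trans
    (Finset.prod_range_succ (fun j => 1 - a * t ^ k * t ^ j) N)

theorem annulusMoment_pos (ht0 : 0 < t) (ha : a < 0) (k : ℤ) : 0 < annulusMoment a t N k := by
  refine Finset.prod_pos fun j _ => ?_
  have : 0 < -a * t ^ k * t ^ j := by
    have := neg_pos.2 ha
    positivity
  linarith

theorem qBinomCoeff_eq_zero (ht0 : 0 < t) {k : ℕ} (hk : N < k) :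
    qBinomCoeff (t ^ N)⁻¹ t k = 0 := by
  refine Finset.prod_eq_zero (Finset.mem_range.2 hk) ?_
  rw [inv_mul_cancel₀ (by positivity), sub_self, zero_div]

/-- Each of the k numerators 1 - t^(j-N) is negative, and is paired with one negative factor a t^N.
-/
theorem qBinomCoeff_mul_pow_pos (ht0 : 0 < t) (ht1 : t < 1) (ha : a < 0) {k : ℕ} (hk : k ≤ N) :
    0 < qBinomCoeff (t ^ N)⁻¹ t k * (a * t ^ N) ^ k := by
  have hpow : (a * t ^ N) ^ k = ∏ _j ∈ Finset.range k, (a * t ^ N) := by simp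
  rw [qBinomCoeff, hpow, ← Finset.prod_mul_distrib]
  refine Finset.prod_pos fun j hj => ?_
  have hjN : j < N := (Finset.mem_range.1 hj).trans_le hk
  have h1 := one_sub_pow_pos ht0 ht1 j
  have h2 : t ^ N < t ^ j := pow_lt_pow_right_of_lt_one₀ ht0 ht1 hjN
  have h3 : (1 - (t ^ N)⁻¹ * t ^ j) / (1 - t ^ (j + 1)) * (a * t ^ N) =
      -a * (t ^ j - t ^ N) / (1 - t ^ (j + 1)) := by
    have : t ^ N ≠ 0 := by positivity
    field_simp
    ring
  rw [h3]
  exact div_pos (mul_pos (neg_pos.2 ha) (sub_pos.2 h2)) h1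

theorem qBinomCoeff_mul_pow_nonneg (ht0 : 0 < t) (ht1 : t < 1) (ha : a < 0) (k : ℕ) :
    0 ≤ qBinomCoeff (t ^ N)⁻¹ t k * (a * t ^ N) ^ k := by
  rcases le_or_gt k N with h | h
  · exact (qBinomCoeff_mul_pow_pos ht0 ht1 ha h).le
  · rw [qBinomCoeff_eq_zero ht0 h, zero_mul]

/-- The q-binomial theorem with B = t^(-N) at z = a t^(N+n): the series terminates, and the quotient
of infinite products collapses to N factors. -/
theorem hasSum_annulusMoment (ht0 : 0 < t) (ht1 : t < 1) (ha : a < 0) (n : ℤ) :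
    HasSum (fun k : ℕ => qBinomCoeff (t ^ N)⁻¹ t k * (a * t ^ N) ^ k * (t ^ n) ^ k)
      (annulusMoment a t N n) := by
  have htn : ‖t‖ < 1 := by rwa [Real.norm_of_nonneg ht0.le]
  set z := a * t ^ N * t ^ n with hz
  have hz0 : z < 0 := by
    have : 0 < -a * t ^ N * t ^ n := by
      have := neg_pos.2 ha
      positivity
    linarith
  have hs : Summable fun k => qBinomCoeff (t ^ N)⁻¹ t k * z ^ k := by
    refine summable_of_ne_finset_zero (s := Finset.range (N + 1)) fun k hk => ?_
    rw [qBinomCoeff_eq_zero ht0 (by simpa using hk), zero_mul]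
  have h1 := tsum_mul_tprod_eq_of_recurrence (𝕜 := ℝ) (t := t) (B := (t ^ N)⁻¹) (z := z) htn
    (c := qBinomCoeff (t ^ N)⁻¹ t) (by simp [qBinomCoeff]) (qBinomCoeff_succ ht0 ht1) hs.norm
  have h2 : ∏' k : ℕ, (1 - z * t ^ k) ≠ 0 := tprod_one_sub_mul_pow_ne_zero htn fun k =>
    (one_sub_mul_pow_pos ht0 ht1 (hz0.trans one_pos) k).ne'
  have hB : (t ^ N)⁻¹ * z = a * t ^ n := by
    rw [hz]
    field_simp
  have hB' : a * t ^ n * t ^ N = z := by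
    rw [hz]
    ring
  rw [hB, tprod_one_sub_mul_pow_eq htn (a * t ^ n) N, hB'] at h1
  have h3 := mul_right_cancel₀ h2 h1
  have h4 := hs.hasSum
  rw [h3] at h4
  refine h4.congr_fun fun k => ?_
  rw [hz, mul_pow (a * t ^ N), mul_assoc]

/-- For b = a t^N everything cancels down to (a t^(N+k); t)_∞ / (a t^k; t)_∞. Negativity of a keeps
all products nonzero, also for negative k. -/
theorem qPoch_div_qPoch (ht0 : 0 < t) (ht1 : t < 1) (ha : a < 0) (k : ℤ) :
    qPochInf ((a * t ^ N : ℝ) : ℂ) t / qPochInf (a : ℂ) t *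
      (qPoch (a : ℂ) t k / qPoch ((a * t ^ N : ℝ) : ℂ) t k) =
        (((annulusMoment a t N k)⁻¹ : ℝ) : ℂ) := by
  have htn : ‖(t : ℂ)‖ < 1 := by rwa [Complex.norm_real, Real.norm_of_nonneg ht0.le]
  have hne : ∀ b : ℝ, b < 0 → qPochInf (b : ℂ) t ≠ 0 := fun b hb =>
    tprod_one_sub_mul_pow_ne_zero htn fun k => by
      exact_mod_cast (one_sub_mul_pow_pos ht0 ht1 (hb.trans one_pos) k).ne'
  have hneg : ∀ b : ℝ, 0 < b → a * b < 0 := fun b hb => mul_neg_of_neg_of_pos ha hb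
  have h1 : qPochInf ((a * t ^ k : ℝ) : ℂ) t = (annulusMoment a t N k : ℂ) *
      qPochInf ((a * t ^ N * t ^ k : ℝ) : ℂ) t := by
    have h2 := tprod_one_sub_mul_pow_eq htn ((a * t ^ k : ℝ) : ℂ) N
    have h3 : ((a * t ^ k : ℝ) : ℂ) * (t : ℂ) ^ N = ((a * t ^ N * t ^ k : ℝ) : ℂ) := by
      push_cast
      ring
    rw [h3] at h2
    rw [qPochInf, h2, qPochInf, annulusMoment]
    push_cast
    rfl
  have e1 := hne a ha
  have e2 := hne (a * t ^ N) (hneg _ (by positivity))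
  have e3 := hne (a * t ^ N * t ^ k) (by
    rw [mul_assoc]
    exact hneg _ (by positivity))
  have e4 : (annulusMoment a t N k : ℂ) ≠ 0 := by
    exact_mod_cast (annulusMoment_pos ht0 ha k).ne'
  rw [qPoch, qPoch, Real.rpow_intCast, ← Complex.ofReal_mul, ← Complex.ofReal_mul, h1]
  push_cast at *
  field_simp

end AnnulusMoment

/-! ### The annulus as a domain carrying circular measures. -/

section Annulus

variable {ρ : ℝ}

theorem subset_closure_annulus (hρ1 : ρ < 1) (hρ0 : 0 < ρ) :
    {z : ℂ | ρ ≤ ‖z‖ ∧ ‖z‖ ≤ 1} ⊆ closure {z : ℂ | ρ < ‖z‖ ∧ ‖z‖ < 1} := by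
  rintro z ⟨hz1, hz2⟩
  have hz0 : 0 < ‖z‖ := hρ0.trans_le hz1
  have h1 : ‖z‖ ∈ closure (Set.Ioo ρ 1) := by
    rw [closure_Ioo hρ1.ne]
    exact ⟨hz1, hz2⟩
  -- Radial rescaling reduces the claim to the closure of an open interval.
  have h2 := map_mem_closure (f := fun s : ℝ => ((s / ‖z‖ : ℝ) : ℂ) * z)
    (t := {z : ℂ | ρ < ‖z‖ ∧ ‖z‖ < 1}) (by fun_prop) h1 fun s hs => by
      have hs0 : 0 < s := hρ0.trans hs.1
      have : ‖((s / ‖z‖ : ℝ) : ℂ) * z‖ = s := by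
        rw [norm_mul, Complex.norm_real, Real.norm_of_nonneg (by positivity)]
        field_simp
      rw [Set.mem_ofPred_eq, this]
      exact hs
  simpa [div_self hz0.ne'] using h2

theorem closure_annulus_subset : closure {z : ℂ | ρ < ‖z‖ ∧ ‖z‖ < 1} ⊆ {z : ℂ | ρ ≤ ‖z‖} :=
  closure_minimal (fun _ hz => hz.1.le) (isClosed_le continuous_const continuous_norm)

theorem isOpen_annulus : IsOpen {z : ℂ | ρ < ‖z‖ ∧ ‖z‖ < 1} :=
  (isOpen_lt continuous_const continuous_norm).inter (isOpen_lt continuous_norm continuous_const)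

theorem isHolCont_zpow_annulus (hρ0 : 0 < ρ) (n : ℤ) :
    IsHolCont {z : ℂ | ρ < ‖z‖ ∧ ‖z‖ < 1} fun z => z ^ n := by
  refine ⟨fun z hz => ?_, fun z hz => ?_⟩
  · exact (differentiableAt_zpow.2
      (Or.inl (norm_pos_iff.1 (hρ0.trans hz.1)))).differentiableWithinAt
  · exact (continuousAt_zpow₀ z n
      (Or.inl (norm_pos_iff.1 (hρ0.trans_le (closure_annulus_subset hz))))).continuousWithinAt

end Annulus

theorem circularSetting_annulus {q a : ℝ} {N : ℕ} (hq0 : 0 < q) (hq1 : q < 1) (ha : a < 0)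
    (hN : 1 ≤ N) {ν : Measure ℂ} (hν : ν = Measure.sum fun k : ℕ => ENNReal.ofReal
      (qBinomCoeff ((q ^ 2) ^ N)⁻¹ (q ^ 2) k * (a * (q ^ 2) ^ N) ^ k) • circleMeasure (q ^ k)) :
    CircularSetting {z : ℂ | q ^ N < ‖z‖ ∧ ‖z‖ < 1} ν (fun n : ℤ => n) (fun k => q ^ k)
      (fun k => qBinomCoeff ((q ^ 2) ^ N)⁻¹ (q ^ 2) k * (a * (q ^ 2) ^ N) ^ k)
      (annulusMoment a (q ^ 2) N) := by
  have ht1 : q ^ 2 < 1 := pow_lt_one₀ hq0.le hq1 two_ne_zero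
  have ht0 : 0 < q ^ 2 := by positivity
  have hρ0 : 0 < q ^ N := by positivity
  have hρ1 : q ^ N < 1 := pow_lt_one₀ hq0.le hq1 (by omega)
  have hkN : ∀ k, qBinomCoeff ((q ^ 2) ^ N)⁻¹ (q ^ 2) k * (a * (q ^ 2) ^ N) ^ k ≠ 0 →
      q ^ N ≤ q ^ k := by
    intro k hk
    refine pow_le_pow_of_le_one hq0.le hq1.le ?_
    by_contra! hcon
    exact hk (by rw [qBinomCoeff_eq_zero ht0 hcon, zero_mul])
  refine
    { isOpen := isOpen_annulus
      conj_mem := fun z hz => by simpa using hz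
      r_pos := fun k => pow_pos hq0 k
      w_nonneg := qBinomCoeff_mul_pow_nonneg ht0 ht1 ha
      measure_eq := hν
      injective := fun _ _ h => h
      M_pos := annulusMoment_pos ht0 ha
      moment := fun n => (hasSum_annulusMoment ht0 ht1 ha n).congr_fun fun k => ?_
      sphere_subset := fun k hk z hz => subset_closure_annulus hρ1 hρ0 ?_
      isHolCont_zpow := isHolCont_zpow_annulus hρ0
      coeff := fun g hg => ⟨fun n => laurentCoeff g 1 n, fun k hk => ⟨fun n => ?_,
        fun n hn => (hn ⟨n, rfl⟩).elim⟩⟩ }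
  · congr 1
    rw [zpow_mul, zpow_ofNat, ← zpow_natCast (_ ^ n), ← zpow_mul, mul_comm n, zpow_mul, zpow_natCast]
    congr 1
    ring
  · rw [mem_sphere_zero_iff_norm] at hz
    rw [Set.mem_ofPred_eq, hz]
    exact ⟨hkN k hk, pow_le_one₀ hq0.le hq1.le⟩
  · refine laurentCoeff_eq_of_annulus (pow_pos hq0 k) (pow_le_one₀ hq0.le hq1.le)
      (hg.2.mono fun z hz => subset_closure_annulus hρ1 hρ0 ?_) (hg.1.mono fun z hz => ?_) n
    · simp only [Set.mem_sdiff, Metric.mem_closedBall, Metric.mem_ball, dist_zero_right,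
        not_lt] at hz
      exact ⟨(hkN k hk).trans hz.2, hz.1⟩
    · simp only [Set.mem_sdiff, Metric.mem_closedBall, Metric.mem_ball, dist_zero_right,
        not_le] at hz
      exact ⟨(hkN k hk).trans_lt hz.2, hz.1⟩

theorem annulusMeasure_eq_sum {q α ε : ℝ} {N : ℕ} (hq0 : 0 < q) (hα : 2 * α + 1 = N) :
    annulusMeasure q α ε N = Measure.sum fun k : ℕ => ENNReal.ofReal
      (qBinomCoeff ((q ^ 2) ^ N)⁻¹ (q ^ 2) k * (-q ^ (-2 * (α + ε)) * (q ^ 2) ^ N) ^ k) •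
        circleMeasure (q ^ k) := by
  have hb : q ^ (-2 * (α + ε)) * (q ^ 2) ^ N = q ^ (2 * (α + 1 - ε)) := by
    rw [← pow_mul, ← Real.rpow_natCast q (2 * N), ← Real.rpow_add hq0]
    congr 1
    push_cast
    rw [← hα]
    ring
  have hB : q ^ (-2 * (2 * α + 1)) = ((q ^ 2) ^ N)⁻¹ := by
    rw [hα, ← pow_mul, ← Real.rpow_natCast q (2 * N), ← Real.rpow_neg hq0.le]
    congr 1
    push_cast
    ring
  have hw : ∀ k : ℕ, (-1) ^ k * q ^ (2 * (k : ℝ) * (α + 1 - ε)) *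
      (qPochNat (q ^ (-2 * (2 * α + 1))) (q ^ 2) k / qPochNat (q ^ 2) (q ^ 2) k) =
      qBinomCoeff ((q ^ 2) ^ N)⁻¹ (q ^ 2) k * (-q ^ (-2 * (α + ε)) * (q ^ 2) ^ N) ^ k := by
    intro k
    have h1 : q ^ (2 * (k : ℝ) * (α + 1 - ε)) = (q ^ (2 * (α + 1 - ε))) ^ k := by
      rw [← Real.rpow_mul_natCast hq0.le]
      congr 1
      ring
    have h2 : qPochNat (q ^ 2) (q ^ 2) k = ∏ j ∈ Finset.range k, (1 - (q ^ 2) ^ (j + 1)) :=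
      Finset.prod_congr rfl fun j _ => by ring
    rw [h1, h2, hB, neg_mul, hb, neg_pow, qBinomCoeff, qPochNat, Finset.prod_div_distrib]
    ring
  ext s hs
  rw [annulusMeasure, Measure.sum_apply _ hs, Measure.finsetSum_apply, tsum_eq_sum]
  · refine Finset.sum_congr rfl fun k _ => ?_
    rw [hw]
  · intro k hk
    rw [qBinomCoeff_eq_zero (by positivity) (by simpa using hk)]
    simp

/-! ### The realization of the strange series in the annulus. -/

namespace UqSU11Rep

variable {q : ℝ} {H : Type*} [NormedAddCommGroup H] [InnerProductSpace ℂ H]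
  {T : UqSU11Rep q H}

theorem norm_sq_mul_annulusMoment {f : ℤ → T.dom} {κ a : ℝ} {N : ℕ} (hq0 : 0 < q) (hq1 : q < 1)
    (hκ : 0 < κ) (ha : a = -(κ * q / q ^ N)) (h0 : ‖f 0‖ ^ 2 * annulusMoment a (q ^ 2) N 0 = 1)
    (hK : ∀ k, T.K (f k) = ((κ * (q ^ 2) ^ k : ℝ) : ℂ) • f k)
    (hE : ∀ k, T.E (f (k + 1)) = ((-((1 + κ * q / q ^ N * (q ^ 2) ^ k) /
        ((1 - q ^ 2) * (κ * (q ^ 2) ^ k))) : ℝ) : ℂ) • f k)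
    (hF : ∀ k, T.F (f k) = ((q * (1 + κ * q * q ^ N * (q ^ 2) ^ k) / (1 - q ^ 2) : ℝ) : ℂ) •
        f (k + 1)) (k : ℤ) : ‖f k‖ ^ 2 * annulusMoment a (q ^ 2) N k = 1 := by
  have ht1 : q ^ 2 < 1 := pow_lt_one₀ hq0.le hq1 two_ne_zero
  have ht2 : 0 < 1 - q ^ 2 := sub_pos.2 ht1
  have ha0 : a < 0 := by
    rw [ha]
    exact neg_neg_of_pos (by positivity)
  have hstep : ∀ k : ℤ, ‖f (k + 1)‖ ^ 2 * annulusMoment a (q ^ 2) N (k + 1) =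
      ‖f k‖ ^ 2 * annulusMoment a (q ^ 2) N k := by
    intro k
    have h1 := mul_norm_sq_eq (by positivity) (hK (k + 1)) (hE k) (hF k)
    have h2 := annulusMoment_succ (a := a) (t := q ^ 2) (N := N) (by positivity) k
    have hp : 0 < (q ^ 2) ^ k := by positivity
    -- The adjoint relation between `E` and `F` produces the two factors of `annulusMoment_succ`, so
    -- the product of squared norm and moment does not depend on k.
    have h3 : (1 - a * (q ^ 2) ^ k) * ‖f k‖ ^ 2 =
        (1 - a * (q ^ 2) ^ k * (q ^ 2) ^ N) * ‖f (k + 1)‖ ^ 2 := by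
      rw [zpow_add_one₀ (by positivity)] at h1
      have e1 : (1 - a * (q ^ 2) ^ k) = 1 + κ * q / q ^ N * (q ^ 2) ^ k := by
        rw [ha]
        ring
      have e2 : (1 - a * (q ^ 2) ^ k * (q ^ 2) ^ N) = 1 + κ * q * q ^ N * (q ^ 2) ^ k := by
        have h5 : 0 < q ^ N := by positivity
        rw [ha, ← pow_mul, mul_comm 2 N, pow_mul q N 2]
        field_simp
        ring
      rw [e1, e2]
      generalize (q ^ 2) ^ k = p at *
      generalize q ^ N = A at *
      generalize 1 + κ * q / A * p = X at *
      generalize 1 + κ * q * A * p = Y at *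
      field_simp at h1
      linear_combination -h1
    have h4 : 0 < 1 - a * (q ^ 2) ^ k := by
      have : 0 < -a * (q ^ 2) ^ k := mul_pos (neg_pos.2 ha0) hp
      linarith
    refine mul_right_cancel₀ h4.ne' ?_
    linear_combination ‖f (k + 1)‖ ^ 2 * h2 - annulusMoment a (q ^ 2) N k * h3
  induction k using Int.induction_on with
  | zero => exact h0
  | succ i ih => rw [hstep, ih]
  | pred i ih =>
    rw [← hstep, sub_add_cancel]
    exact ih

theorem isWeightFamily_int {f : ℤ → T.dom} {κ : ℝ} {γ φ : ℤ → ℂ} (hq0 : 0 < q) (hq1 : q < 1)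
    (hκ : 0 < κ) (hf : ∀ k, f k ≠ 0)
    (hK : ∀ k, T.K (f k) = ((κ * (q ^ 2) ^ k : ℝ) : ℂ) • f k)
    (hE : ∀ k, T.E (f (k + 1)) = γ k • f k) (hF : ∀ k, T.F (f k) = φ k • f (k + 1)) :
    IsWeightFamily T f fun k => κ * (q ^ 2) ^ k where
  injective := fun i j hij => by
    have ht1 : q ^ 2 < 1 := pow_lt_one₀ hq0.le hq1 two_ne_zero
    exact zpow_right_injective₀ (by positivity) ht1.ne (mul_left_cancel₀ hκ.ne' hij)
  weight_ne_zero := fun i => by positivity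
  ne_zero := hf
  K_apply := hK
  E_mem := fun i => by
    have := hE (i - 1)
    rw [sub_add_cancel] at this
    rw [this]
    exact Submodule.smul_mem _ _ (Submodule.subset_span ⟨_, rfl⟩)
  F_mem := fun i => by
    rw [hF]
    exact Submodule.smul_mem _ _ (Submodule.subset_span ⟨_, rfl⟩)

end UqSU11Rep

theorem summable_pow_natAbs {r : ℝ} (hr0 : 0 ≤ r) (hr1 : r < 1) :
    Summable fun k : ℤ => r ^ k.natAbs := by
  refine Summable.of_nat_of_neg ?_ ?_ <;>
    simpa using summable_geometric_of_lt_one hr0 hr1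

theorem coherent_bound_annulus {H : Type*} [NormedAddCommGroup H] {q a : ℝ} {N : ℕ} (hq0 : 0 < q)
    (hq1 : q < 1) (ha : a < 0) {f : ℤ → H}
    (hf : ∀ k, ‖f k‖ ^ 2 * annulusMoment a (q ^ 2) N k = 1) {z : ℂ}
    (hz : z ∈ {z : ℂ | q ^ N < ‖z‖ ∧ ‖z‖ < 1}) :
    ∃ V, IsOpen V ∧ z ∈ V ∧ ∃ u : ℤ → ℝ, Summable u ∧ ∀ i, ∀ x ∈ V, ‖x ^ i‖ * ‖f i‖ ≤ u i := by
  have ht1 : q ^ 2 < 1 := pow_lt_one₀ hq0.le hq1 two_ne_zero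
  have ht0 : 0 < q ^ 2 := by positivity
  have hqN : 0 < q ^ N := by positivity
  obtain ⟨r₁, h1, h2⟩ := exists_between hz.1
  obtain ⟨r₂, h3, h4⟩ := exists_between hz.2
  have hr₁ : 0 < r₁ := hqN.trans h1
  have hr₂ : 0 < r₂ := (norm_nonneg z).trans_lt h3
  have hle : ∀ (k : ℕ) (n : ℤ), qBinomCoeff ((q ^ 2) ^ N)⁻¹ (q ^ 2) k * (a * (q ^ 2) ^ N) ^ k *
      ((q ^ 2) ^ n) ^ k ≤ annulusMoment a (q ^ 2) N n := fun k n =>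
    le_hasSum (hasSum_annulusMoment ht0 ht1 ha n) k fun j _ =>
      mul_nonneg (qBinomCoeff_mul_pow_nonneg ht0 ht1 ha j) (by positivity)
  -- The moment dominates each of its terms. The outer circle (k = 0, weight 1) gives this bound,
  -- which controls positive powers.
  have hf1 : ∀ n, ‖f n‖ ≤ 1 := by
    intro n
    have h5 := hle 0 n
    have h6 := hf n
    simp only [qBinomCoeff, Finset.range_zero, Finset.prod_empty, pow_zero, mul_one] at h5
    have h7 : ‖f n‖ ^ 2 ≤ 1 := by nlinarith [sq_nonneg ‖f n‖]
    exact (sq_le_one_iff₀ (norm_nonneg _)).1 h7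
  set w := qBinomCoeff ((q ^ 2) ^ N)⁻¹ (q ^ 2) N * (a * (q ^ 2) ^ N) ^ N with hw
  have hw0 : 0 < w := qBinomCoeff_mul_pow_pos ht0 ht1 ha le_rfl
  -- The innermost circle (k = N) gives decay of the norms as n → -∞, which controls negative powers
  -- where |z| > q^N.
  have hf2 : ∀ n : ℤ, ‖f n‖ ≤ (√w)⁻¹ * (q ^ N) ^ (-n) := by
    intro n
    have h5 := hle N n
    have h6 := hf n
    rw [← hw] at h5
    have h8 : ((q ^ 2) ^ n) ^ N = ((q ^ N) ^ n) ^ 2 := by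
      rw [← zpow_natCast (_ ^ n) N, ← zpow_mul, mul_comm n, zpow_mul, zpow_natCast,
        ← zpow_natCast (_ ^ n) 2, ← zpow_mul, mul_comm n, zpow_mul, zpow_natCast]
      congr 1
      ring
    rw [h8] at h5
    have hs : 0 < √w := Real.sqrt_pos.2 hw0
    have hp : 0 < (q ^ N) ^ n := by positivity
    rw [zpow_neg, ← mul_inv, ← one_div, le_div_iff₀ (by positivity)]
    refine (sq_le_one_iff₀ (by positivity)).1 ?_
    calc (‖f n‖ * (√w * (q ^ N) ^ n)) ^ 2 = ‖f n‖ ^ 2 * (√w ^ 2 * ((q ^ N) ^ n) ^ 2) := by ring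
      _ = ‖f n‖ ^ 2 * (w * ((q ^ N) ^ n) ^ 2) := by rw [Real.sq_sqrt hw0.le]
      _ ≤ ‖f n‖ ^ 2 * annulusMoment a (q ^ 2) N n := by gcongr
      _ = 1 := h6
  refine ⟨{x : ℂ | r₁ < ‖x‖} ∩ {x : ℂ | ‖x‖ < r₂},
    (isOpen_lt continuous_const continuous_norm).inter
      (isOpen_lt continuous_norm continuous_const), ⟨h2, h3⟩,
    fun n => r₂ ^ n.natAbs + (√w)⁻¹ * (q ^ N / r₁) ^ n.natAbs,
    (summable_pow_natAbs hr₂.le h4).add ((summable_pow_natAbs (by positivity)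
      ((div_lt_one hr₁).2 h1)).mul_left _), fun n x hx => ?_⟩
  have hx1 : r₁ < ‖x‖ := hx.1
  have hx2 : ‖x‖ < r₂ := hx.2
  have hx0 : 0 < ‖x‖ := hr₁.trans hx1
  rw [norm_zpow]
  rcases le_or_gt 0 n with hn | hn
  · obtain ⟨k, rfl⟩ := Int.eq_ofNat_of_zero_le hn
    have h5 : ‖x‖ ^ (k : ℤ) * ‖f k‖ ≤ r₂ ^ k * 1 := by
      rw [zpow_natCast]
      gcongr
      exact hf1 k
    have h6 : 0 ≤ (√w)⁻¹ * (q ^ N / r₁) ^ k := by positivity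
    simp only [Int.natAbs_natCast]
    linarith
  · obtain ⟨k, rfl⟩ : ∃ k : ℕ, n = -k := ⟨n.natAbs, by omega⟩
    have h5 : ‖x‖ ^ (-(k : ℤ)) * ‖f (-k)‖ ≤ (√w)⁻¹ * (q ^ N / r₁) ^ k := by
      have h6 := hf2 (-k)
      rw [neg_neg, zpow_natCast] at h6
      have h7 : (‖x‖ ^ k)⁻¹ ≤ (r₁ ^ k)⁻¹ := by gcongr
      calc ‖x‖ ^ (-(k : ℤ)) * ‖f (-k)‖ ≤ (r₁ ^ k)⁻¹ * ((√w)⁻¹ * (q ^ N) ^ k) := by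
            rw [zpow_neg, zpow_natCast]
            gcongr
        _ = (√w)⁻¹ * (q ^ N / r₁) ^ k := by
            rw [div_pow]
            field_simp
    have h6 : 0 ≤ r₂ ^ k := by positivity
    simp only [Int.natAbs_neg, Int.natAbs_natCast]
    linarith

namespace UqSU11Rep

variable {q : ℝ} {H : Type*} [NormedAddCommGroup H] [InnerProductSpace ℂ H]
  {T : UqSU11Rep q H}

/-- The strange series has an orthogonal basis of weight vectors on which the normalized coordinate
acts as a shift, with the norms of the Laurent monomials. -/
theorem exists_basis_of_isStrange (hq0 : 0 < q) (hq1 : q < 1) {α ε : ℝ} {N : ℕ}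
    (hα : 2 * α + 1 = N) (hT : T.IsStrange α ε) :
    ∃ f : ℤ → T.dom, IsWeightFamily T f (fun k => q ^ (-2 * ε) * (q ^ 2) ^ k) ∧
      (∀ k, ‖f k‖ ^ 2 * annulusMoment (-q ^ (-2 * (α + ε))) (q ^ 2) N k = 1) ∧
      ∀ k, ((q ^ N : ℝ) : ℂ) • T.zeta (-1) (q ^ N) (f (k + 1)) = f k := by
  obtain ⟨-, hirr, hC, v, hv, hK⟩ := hT
  have ht1 : q ^ 2 < 1 := pow_lt_one₀ hq0.le hq1 two_ne_zero
  have ht2 : 0 < 1 - q ^ 2 := sub_pos.2 ht1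
  have hκ : 0 < q ^ (-2 * ε) := Real.rpow_pos_of_pos hq0 _
  have hA : 0 < q ^ N := by positivity
  have ha : -q ^ (-2 * (α + ε)) = -(q ^ (-2 * ε) * q / q ^ N) := by
    rw [← Real.rpow_natCast q N, ← hα, ← Real.rpow_add_one hq0.ne', ← Real.rpow_sub hq0]
    congr 2
    ring
  have ha0 : -q ^ (-2 * (α + ε)) < 0 := neg_neg_of_pos (Real.rpow_pos_of_pos hq0 _)
  have hM0 := annulusMoment_pos (a := -q ^ (-2 * (α + ε))) (t := q ^ 2) (N := N) (by positivity)
    ha0 0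
  rw [casimirValue_strange hq0 hq1 hα] at hC
  have hv0 : ‖v‖ ≠ 0 := norm_ne_zero_iff.2 hv
  -- The starting vector is scaled so that ‖f 0‖² times the zeroth moment is 1; the recurrence then
  -- propagates this to every index.
  obtain ⟨f, h0, hfK, hfE, hfF⟩ := exists_strangeFamily hq0 hq1 hκ hA hC
    (u := (((‖v‖⁻¹ * √(annulusMoment (-q ^ (-2 * (α + ε))) (q ^ 2) N 0)⁻¹ : ℝ)) : ℂ) • v) (by
      rw [map_smul, hK, smul_comm])
  have hnorm := norm_sq_mul_annulusMoment hq0 hq1 hκ ha (by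
    rw [h0, norm_smul, Complex.norm_real, Real.norm_of_nonneg (by positivity), mul_right_comm,
      inv_mul_cancel₀ hv0, one_mul, Real.sq_sqrt (by positivity), inv_mul_cancel₀ hM0.ne'])
    hfK hfE hfF
  have hne : ∀ k, f k ≠ 0 := by
    intro k hk
    have := hnorm k
    rw [hk, norm_zero] at this
    simp at this
  have W := isWeightFamily_int hq0 hq1 hκ hne hfK hfE hfF
  -- With s = -1 the eigenvalues of qx are negative while c is positive, so qx - c is invertible.
  have hneq : ∀ k : ℤ, q * (-1 * (q ^ (-2 * ε) * (q ^ 2) ^ k)) ≠ q ^ N := by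
    intro k h
    have : 0 < q * (q ^ (-2 * ε) * (q ^ 2) ^ k) := by positivity
    linarith
  refine ⟨f, W, hnorm, fun k => ?_⟩
  rw [W.zeta_apply hirr hneq (hfE k) (hfK k) (hneq k), smul_smul, ← Complex.ofReal_mul]
  have hp : 0 < (q ^ 2) ^ k := by positivity
  have h1 : q ^ N * (-(1 - q ^ 2) * -1 * (q ^ (-2 * ε) * (q ^ 2) ^ k) *
      -((1 + q ^ (-2 * ε) * q / q ^ N * (q ^ 2) ^ k) /
        ((1 - q ^ 2) * (q ^ (-2 * ε) * (q ^ 2) ^ k))) /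
      (q * (-1 * (q ^ (-2 * ε) * (q ^ 2) ^ k)) - q ^ N)) = 1 := by
    have h2 : q * (-1 * (q ^ (-2 * ε) * (q ^ 2) ^ k)) - q ^ N =
        -(q ^ N * (1 + q ^ (-2 * ε) * q / q ^ N * (q ^ 2) ^ k)) := by
      field_simp
      ring
    have h3 : 0 < 1 + q ^ (-2 * ε) * q / q ^ N * (q ^ 2) ^ k := by positivity
    rw [h2]
    generalize 1 + q ^ (-2 * ε) * q / q ^ N * (q ^ 2) ^ k = X at *
    generalize (q ^ 2) ^ k = p at *
    generalize q ^ N = A at *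
    generalize q ^ (-2 * ε) = κ at *
    field_simp
  rw [h1, Complex.ofReal_one, one_smul]

/-- The realization of the strange series in an annulus. -/
theorem exists_annulusRealization [CompleteSpace H] (hq0 : 0 < q) (hq1 : q < 1) {α ε : ℝ} {N : ℕ}
    (hN : 1 ≤ N) (hα : 2 * α + 1 = N) (hT : T.IsStrange α ε) :
    ∃ Θ : ℂ → H,
      DifferentiableOn ℂ Θ {z | q ^ N < ‖z‖ ∧ ‖z‖ < 1} ∧
      (∀ z ∈ {z : ℂ | q ^ N < ‖z‖ ∧ ‖z‖ < 1},
        (Θ z, z • Θ z) ∈ (T.zetaClosed (-1) (q ^ (2 * α + 1))).graph) ∧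
      (∀ z ∈ {z : ℂ | q ^ N < ‖z‖ ∧ ‖z‖ < 1}, ∀ w ∈ {z : ℂ | q ^ N < ‖z‖ ∧ ‖z‖ < 1},
        let a : ℂ := ((-q ^ (-2 * (α + ε)) : ℝ) : ℂ)
        let b : ℂ := ((-q ^ (2 * (α + 1 - ε)) : ℝ) : ℂ)
        Summable (psiTerm a b (q ^ 2) (z * starRingEnd ℂ w)) ∧
        inner ℂ (Θ w) (Θ z) =
          qPochInf b ((q : ℂ) ^ 2) / qPochInf a ((q : ℂ) ^ 2) *
            ramanujanPsi a b (q ^ 2) (z * starRingEnd ℂ w)) ∧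
      IsHolomorphicRealization Θ {z | q ^ N < ‖z‖ ∧ ‖z‖ < 1} (annulusMeasure q α ε N) := by
  obtain ⟨f, W, hnorm, hshift⟩ := exists_basis_of_isStrange hq0 hq1 hα hT
  have hirr := hT.2.1
  have ht1 : q ^ 2 < 1 := pow_lt_one₀ hq0.le hq1 two_ne_zero
  have ht0 : 0 < q ^ 2 := by positivity
  have ha0 : -q ^ (-2 * (α + ε)) < 0 := neg_neg_of_pos (Real.rpow_pos_of_pos hq0 _)
  have hc : q ^ (2 * α + 1) = q ^ N := by rw [hα, Real.rpow_natCast]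
  have hb : -q ^ (2 * (α + 1 - ε)) = -q ^ (-2 * (α + ε)) * (q ^ 2) ^ N := by
    rw [← pow_mul, ← Real.rpow_natCast q (2 * N), neg_mul, ← Real.rpow_add hq0]
    congr 2
    push_cast
    rw [← hα]
    ring
  have S := circularSetting_annulus hq0 hq1 ha0 hN (annulusMeasure_eq_sum (ε := ε) hq0 hα)
  have C : CoherentSystem {z : ℂ | q ^ N < ‖z‖ ∧ ‖z‖ < 1} (fun n : ℤ => n)
      (annulusMoment (-q ^ (-2 * (α + ε))) (q ^ 2) N) fun k => (f k : H) :=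
    { inner_eq_zero := fun i j hij => W.inner_eq_zero hij
      norm_sq_mul := hnorm
      dense_span := W.topologicalClosure_span_eq_top hirr
      bound := fun z hz => coherent_bound_annulus hq0 hq1 ha0 hnorm hz }
  refine ⟨fun z => ∑' n : ℤ, z ^ n • (f n : H),
    C.differentiableOn (fun n => (S.isHolCont_zpow n).1) S.isOpen, fun z hz => ?_,
    fun z hz x hx => ?_, C.isHolomorphicRealization S⟩
  · rw [hc]
    have hz0 : z ≠ 0 := norm_pos_iff.1 ((pow_pos hq0 N).trans hz.1)
    have hshift' : ∀ k, ((q ^ N : ℝ) : ℂ) • T.zeta (-1) (q ^ N) (f k) = f (k - 1) := fun k => by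
      have := hshift (k - 1)
      rwa [sub_add_cancel] at this
    have hsum := (C.summable hz).hasSum
    refine W.mem_graph_zetaClosed hirr (fun i => ?_) hsum ?_
    · refine ⟨(((‖f i‖ ^ 2 / ‖f (i + 1)‖ ^ 2 : ℝ)) : ℂ) • (f (i + 1) : H), fun j => ?_⟩
      rw [hshift', inner_smul_left]
      by_cases hij : i = j - 1
      · obtain rfl : j = i + 1 := by omega
        have h1 : (‖f (i + 1)‖ : ℂ) ≠ 0 := by
          exact_mod_cast norm_ne_zero_iff.2 (W.ne_zero (i + 1))
        rw [add_sub_cancel_right, inner_self_eq_norm_sq_to_K, inner_self_eq_norm_sq_to_K,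
          Complex.conj_ofReal, ← Submodule.coe_norm, ← Submodule.coe_norm]
        simp only [Complex.coe_algebraMap]
        push_cast
        field_simp
      · rw [W.inner_eq_zero hij, W.inner_eq_zero (fun h => hij (by omega)), mul_zero]
    · simp only [hshift']
      -- Reindexing by k ↦ k - 1 exhibits the shifted series as z Θ(z).
      have h1 := (Equiv.subRight (1 : ℤ)).hasSum_iff.2 (hsum.const_smul z)
      refine h1.congr_fun fun k => ?_
      simp only [Function.comp_apply, Equiv.subRight_apply]
      rw [smul_smul, ← zpow_one_add₀ hz0, add_sub_cancel]
  · intro a b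
    have h1 := C.hasSum_inner hz hx
    have h2 : ∀ k : ℤ, ((‖(f k : H)‖ ^ 2 : ℝ) : ℂ) * (z * starRingEnd ℂ x) ^ k =
        qPochInf b ((q : ℂ) ^ 2) / qPochInf a ((q : ℂ) ^ 2) *
          psiTerm a b (q ^ 2) (z * starRingEnd ℂ x) k := by
      intro k
      have h3 := qPoch_div_qPoch (N := N) ht0 ht1 ha0 k
      rw [← hb] at h3
      rw [psiTerm, ← mul_assoc]
      congr 1
      rw [← Submodule.coe_norm, eq_inv_of_mul_eq_one_left (hnorm k), ← h3, Complex.ofReal_pow]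
    simp_rw [h2] at h1
    -- If the prefactor vanished, the term of index 0 would give ‖f 0‖ = 0. Being nonzero, it can be
    -- divided out to get summability of Ramanujan's series from that of the kernel.
    have h4 : qPochInf b ((q : ℂ) ^ 2) / qPochInf a ((q : ℂ) ^ 2) ≠ 0 := by
      intro h
      have h5 := h2 0
      rw [h, zero_mul, zpow_zero, mul_one] at h5
      have h6 := norm_ne_zero_iff.2 (W.ne_zero 0)
      rw [Submodule.coe_norm] at h6
      exact pow_ne_zero 2 h6 (by exact_mod_cast h5)
    refine ⟨(summable_mul_left_iff h4).1 h1.summable, ?_⟩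
    rw [ramanujanPsi, ← tsum_mul_left]
    exact h1.tsum_eq.symm

end UqSU11Rep

end

theorem mainTheorem11 (q : ℝ) (hq0 : 0 < q) (hq1 : q < 1)
    {H : Type*} [NormedAddCommGroup H] [InnerProductSpace ℂ H] [CompleteSpace H]
    (T : UqSU11Rep q H) :
    (∀ l ε : ℝ, l ≤ -1 / 2 → T.IsHolomorphicDiscrete l ε →
      ∃ Θ : ℂ → H,
        DifferentiableOn ℂ Θ (Metric.ball 0 1) ∧
        (∀ z ∈ Metric.ball (0 : ℂ) 1,
          (Θ z, z • Θ z) ∈ (T.zetaClosed 1 (q ^ (2 * l + 1))).graph) ∧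
        (∀ z ∈ Metric.ball (0 : ℂ) 1, ∀ w ∈ Metric.ball (0 : ℂ) 1,
          inner ℂ (Θ w) (Θ z) = 1 / qPoch (z * starRingEnd ℂ w) (q ^ 2) (-2 * l)) ∧
        IsHolomorphicRealization Θ (Metric.ball 0 1) (discMeasure q l)) ∧
    (∀ (α ε : ℝ) (N : ℕ), 1 ≤ N → 2 * α + 1 = N → T.IsStrange α ε →
      ∃ Θ : ℂ → H,
        DifferentiableOn ℂ Θ {z | q ^ N < ‖z‖ ∧ ‖z‖ < 1} ∧
        (∀ z ∈ {z : ℂ | q ^ N < ‖z‖ ∧ ‖z‖ < 1},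
          (Θ z, z • Θ z) ∈ (T.zetaClosed (-1) (q ^ (2 * α + 1))).graph) ∧
        (∀ z ∈ {z : ℂ | q ^ N < ‖z‖ ∧ ‖z‖ < 1}, ∀ w ∈ {z : ℂ | q ^ N < ‖z‖ ∧ ‖z‖ < 1},
          let a : ℂ := ((-q ^ (-2 * (α + ε)) : ℝ) : ℂ)
          let b : ℂ := ((-q ^ (2 * (α + 1 - ε)) : ℝ) : ℂ)
          Summable (psiTerm a b (q ^ 2) (z * starRingEnd ℂ w)) ∧
          inner ℂ (Θ w) (Θ z) =
            qPochInf b ((q : ℂ) ^ 2) / qPochInf a ((q : ℂ) ^ 2) *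
              ramanujanPsi a b (q ^ 2) (z * starRingEnd ℂ w)) ∧
        IsHolomorphicRealization Θ {z | q ^ N < ‖z‖ ∧ ‖z‖ < 1} (annulusMeasure q α ε N)) := by
  exact ⟨fun _ _ hl hT => UqSU11Rep.exists_discRealization hq0 hq1 hl hT,
    fun _ _ _ hN hα hT => UqSU11Rep.exists_annulusRealization hq0 hq1 hN hα hT⟩
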